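/- Let $\Sigma$ be a closed oriented smooth surface, and let $K$ be an oriented knot in $\Sigma\times[0,1]$, i.e. a smooth embedding of the oriented circle $S^1$, whose projection to $\Sigma$ is a knot diagram $D$ (an immersed curve whose only multiple points are finitely many transverse double points, the crossings). At a crossing $c$ the over-arc is the branch with the larger $[0,1]$-coordinate. The writhe $w(c)\in\{1,-1\}$ is $+1$ if (tangent vector of the over-arc, tangent vector of the under-arc) is a positively oriented basis of $T_c\Sigma$, and $-1$ otherwise. The Gauss diagram of $D$ is the counterclockwise oriented circle $S^1$ with one chord for each crossing $c$, directed from the preimage of the overcrossing to the preimage of the undercrossing and carrying the sign $w(c)$. For a chord $c$ let $r_\pm(c)$ be the number of chords of sign $\pm$ crossing $c$ from left to right and $l_\pm(c)$ the number of those crossing $c$ from right to left. Put $$\mathrm{Ind}(c)=r_+(c)-r_-(c)-l_+(c)+l_-(c),\qquad W_K(t)=\sum_{\mathrm{Ind}(c)\ne 0}w(c)\,t^{\mathrm{Ind}(c)}\in\mathbb Z[t,t^{-1}].$$ Let $\gamma$ be a smooth oriented closed curve on $\Sigma$ that is transverse to $D$ and does not pass through the crossings of $D$. A coloring of $D$ with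 respect to $\gamma$ assigns an integer to each of the parts into which $\gamma$ divides $D$, such that, when one walks along $D$ in its direction, the integer increases by one at each intersection point with $\gamma$ where (tangent vector of $D$, tangent vector of $\gamma$) is positively oriented, and decreases by one at each intersection point where this pair is negatively oriented (if $\gamma$ passes through a point of $D$ several times, all passages are counted). Given a coloring, let $f_\gamma(c)$ be the integer on the over-arc minus the integer on the under-arc at the crossing $c$, and let $$W_K^\gamma(t)=\sum_{f_\gamma(c)\ne 0}w(c)\,t^{f_\gamma(c)}.$$ **Lemma.** If $[\gamma]=[K]$ in $H_1(\Sigma;\mathbb Z)$, where $[K]$ is the class of the projection of $K$, then a coloring of $D$ with respect to $\gamma$ exists, and for every such coloring $f_\gamma(c)=\mathrm{Ind}(c)$ for every crossing $c$. Hence $W_K^\gamma(t)=W_K(t)$. -/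

import Mathlib

open scoped Manifold ContDiff Topology

universe u

/-! ### Homology classes of closed curves -/

section Homology

open CategoryTheory AlgebraicTopology Simplicial

/-- The first singular homology group `H₁(X; ℤ)` (Mathlib's singular homology; the coefficient
group `ℤ` is lifted to the universe of `X`). -/
noncomputable abbrev singularH1 (X : Type u) [TopologicalSpace X] : ModuleCat.{u} ℤ :=
  ((singularHomologyFunctor (ModuleCat.{u} ℤ) 1).obj (ModuleCat.of ℤ (ULift.{u} ℤ))).obj
    (TopCat.of X)

variable {X : Type u} [TopologicalSpace X]

/-- The singular 1-simplex `(x₀, x₁) ↦ γ (x₁ mod 1)` that runs once around a closed curve `γ`,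
in the direction of `γ`. -/
noncomputable def loopSimplex (γ : C(UnitAddCircle, X)) :
    (TopCat.toSSet.obj (TopCat.of X)) _⦋1⦌ :=
  (TopCat.toSSetObjEquiv (TopCat.of X) (.op ⦋1⦌)).symm
    ⟨fun x => γ ((x.1 1 : ℝ) : UnitAddCircle), by
      refine γ.continuous.comp ((AddCircle.continuous_mk' 1).comp ?_)
      exact (continuous_apply _).comp continuous_subtype_val⟩

theorem loopSimplex_δ (γ : C(UnitAddCircle, X)) :
    (TopCat.toSSet.obj (TopCat.of X)).δ 0 (loopSimplex γ) =
      (TopCat.toSSet.obj (TopCat.of X)).δ 1 (loopSimplex γ) := by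
  apply (TopCat.toSSetObjEquiv (TopCat.of X) (.op ⦋0⦌)).injective
  refine ContinuousMap.ext fun x => ?_
  refine (TopCat.toSSetObjEquiv_δ_apply (X := TopCat.of X) (n := 0) (loopSimplex γ) 0 x).trans
    (Eq.trans ?_ (TopCat.toSSetObjEquiv_δ_apply (X := TopCat.of X) (n := 0)
      (loopSimplex γ) 1 x).symm)
  have hx : x = stdSimplex.vertex (S := ℝ) (0 : Fin 1) := Subsingleton.elim _ _
  subst hx
  rw [loopSimplex, Equiv.apply_symm_apply]
  have h0 : stdSimplex.map (S := ℝ) (0 : Fin 2).succAbove (stdSimplex.vertex (0 : Fin 1)) =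
      stdSimplex.vertex (1 : Fin 2) := by rw [stdSimplex.map_vertex]; rfl
  have h1 : stdSimplex.map (S := ℝ) (1 : Fin 2).succAbove (stdSimplex.vertex (0 : Fin 1)) =
      stdSimplex.vertex (0 : Fin 2) := by rw [stdSimplex.map_vertex]; rfl
  rw [h0, h1]
  change γ _ = γ _
  congr 1
  simp

/-- `loopSimplex γ` is a singular 1-cycle. -/
theorem ι_loopSimplex_d (γ : C(UnitAddCircle, X)) :
    (TopCat.toSSet.obj (TopCat.of X)).ιChainComplex (R := ModuleCat.of ℤ (ULift.{u} ℤ))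
        (loopSimplex γ) ≫
      ((TopCat.toSSet.obj (TopCat.of X)).chainComplex (ModuleCat.of ℤ (ULift.{u} ℤ))).d 1 0 =
        0 := by
  rw [SSet.ιChainComplex_d]
  simp [Fin.sum_univ_two, loopSimplex_δ]

/-- The homology class `[γ] ∈ H₁(X; ℤ)` of an oriented closed curve `γ`: the class of the
1-cycle `loopSimplex γ`. -/
noncomputable def loopClass (γ : C(UnitAddCircle, X)) : singularH1 X :=
  (((TopCat.toSSet.obj (TopCat.of X)).chainComplex (ModuleCat.of ℤ (ULift.{u} ℤ))).liftCycles
      ((TopCat.toSSet.obj (TopCat.of X)).ιChainComplex (loopSimplex γ)) 0 (by simp)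
      (ι_loopSimplex_d γ) ≫
    ((TopCat.toSSet.obj (TopCat.of X)).chainComplex
      (ModuleCat.of ℤ (ULift.{u} ℤ))).homologyπ 1).hom (ULift.up (1 : ℤ))

end Homology

/-! ### Oriented surfaces, closed curves, knots in thickened surfaces -/

/-- The model space of surfaces. -/
abbrev Plane : Type := EuclideanSpace ℝ (Fin 2)

/-- An oriented smooth surface is given by an oriented atlas: all changes of charts have positive
Jacobian determinant. The tangent space at `x`, which Mathlib identifies with the plane through
the preferred chart at `x`, is oriented by the standard orientation of the plane. -/
class OrientedAtlas (S : Type u) [TopologicalSpace S] [ChartedSpace Plane S] : Prop where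
  det_pos : ∀ e ∈ atlas Plane S, ∀ e' ∈ atlas Plane S, ∀ x ∈ e.source ∩ e'.source,
    0 < (fderiv ℝ (e' ∘ e.symm) (e x)).det

/-- The determinant of the pair `(v, w)` of plane vectors; the pair is positively oriented
if and only if it is positive. -/
noncomputable def area (v w : Plane) : ℝ := v 0 * w 1 - v 1 * w 0

section Curves

variable {S : Type u} [TopologicalSpace S] [ChartedSpace Plane S]

/-- The velocity at the parameter `θ ∈ ℝ/ℤ` of a map from the circle to a surface. -/
noncomputable def velocity (f : UnitAddCircle → S) (θ : UnitAddCircle) : Plane :=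
  mfderiv 𝓘(ℝ, ℝ) (𝓡 2) (fun r : ℝ => f (θ + (r : UnitAddCircle))) 0 (1 : ℝ)

/-- For `f θ = g θ'`: the determinant of the pair of tangent vectors of `f` at `θ` and of `g` at
`θ'`, which lie in the same oriented tangent plane. -/
noncomputable def tangentArea (f g : UnitAddCircle → S) (θ θ' : UnitAddCircle) : ℝ :=
  area (velocity f θ) (velocity g θ')

end Curves

/-- A smooth oriented closed curve on a surface, as a map from the oriented circle `ℝ/ℤ`. -/
structure ClosedCurve (S : Type u) [TopologicalSpace S] [ChartedSpace Plane S] where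
  toFun : UnitAddCircle → S
  smooth : ContMDiff 𝓘(ℝ, ℝ) (𝓡 2) ∞ (fun t : ℝ => toFun (t : UnitAddCircle))

/-- An oriented knot in `S × [0, 1]`: a smooth embedding of the oriented circle `ℝ/ℤ`, given by
its two components. (An injective immersion of a compact manifold is an embedding.) -/
structure ThickenedKnot (S : Type u) [TopologicalSpace S] [ChartedSpace Plane S] where
  /-- the projection of the knot to the surface -/
  proj : ClosedCurve S
  /-- the component of the knot in the interval -/
  height : UnitAddCircle → ℝ
  height_mem : ∀ θ, height θ ∈ Set.Icc (0 : ℝ) 1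
  height_smooth : ContDiff ℝ ∞ (fun t : ℝ => height (t : UnitAddCircle))
  injective : Function.Injective fun θ => (proj.toFun θ, height θ)
  immersion : ∀ θ, velocity proj.toFun θ ≠ 0 ∨
    deriv (fun r : ℝ => height (θ + (r : UnitAddCircle))) 0 ≠ 0

section Classes

variable {S : Type u} [TopologicalSpace S] [ChartedSpace Plane S]

theorem ClosedCurve.continuous_toFun (γ : ClosedCurve S) : Continuous γ.toFun :=
  (QuotientAddGroup.isQuotientMap_mk (N := AddSubgroup.zmultiples (1 : ℝ))).continuous_iff.2
    γ.smooth.continuous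

/-- The class `[γ] ∈ H₁(S; ℤ)` of a closed curve. -/
noncomputable def ClosedCurve.homologyClass (γ : ClosedCurve S) : singularH1 S :=
  loopClass ⟨γ.toFun, γ.continuous_toFun⟩

/-- The class `[K] ∈ H₁(S; ℤ)` of a knot in `S × [0, 1]`: the class of its projection to `S`. -/
noncomputable def ThickenedKnot.homologyClass (K : ThickenedKnot S) : singularH1 S :=
  K.proj.homologyClass

end Classes

/-! ### Gauss diagrams -/

/-- A Gauss diagram: finitely many directed signed chords, with pairwise distinct endpoints, of
the counterclockwise oriented circle `ℝ/ℤ`. -/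
structure GaussDiagram where
  Chord : Type
  finite : Finite Chord
  tail : Chord → UnitAddCircle
  head : Chord → UnitAddCircle
  sign : Chord → ℤˣ
  endpoints_injective : Function.Injective (Sum.elim tail head)

namespace GaussDiagram

variable (G : GaussDiagram)

/-- The open arc of the circle to the right of the chord `c`. Going counterclockwise, it runs from
the tail to the head of `c`. -/
def rightArc (c : G.Chord) : Set UnitAddCircle := Set.cIoo (G.tail c) (G.head c)

/-- The open arc of the circle to the left of the chord `c`. Going counterclockwise, it runs from
the head to the tail of `c`. -/
def leftArc (c : G.Chord) : Set UnitAddCircle := Set.cIoo (G.head c) (G.tail c)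

/-- The number of chords of sign `ε` that cross `c` from left to right. -/
noncomputable def numLeftToRight (ε : ℤˣ) (c : G.Chord) : ℕ :=
  Nat.card {c' : G.Chord // G.sign c' = ε ∧ G.tail c' ∈ G.leftArc c ∧ G.head c' ∈ G.rightArc c}

/-- The number of chords of sign `ε` that cross `c` from right to left. -/
noncomputable def numRightToLeft (ε : ℤˣ) (c : G.Chord) : ℕ :=
  Nat.card {c' : G.Chord // G.sign c' = ε ∧ G.tail c' ∈ G.rightArc c ∧ G.head c' ∈ G.leftArc c}

/-- The chord index `Ind(c) = r₊(c) - r₋(c) - l₊(c) + l₋(c)`. -/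
noncomputable def ind (c : G.Chord) : ℤ :=
  (G.numLeftToRight 1 c : ℤ) - G.numLeftToRight (-1) c
    - G.numRightToLeft 1 c + G.numRightToLeft (-1) c

end GaussDiagram

/-- The Laurent polynomial `∑ w(c) t ^ f(c)`, the sum running over all `c` with `f(c) ≠ 0`. -/
noncomputable def writheSum {ι : Type} (w : ι → ℤˣ) (f : ι → ℤ) : LaurentPolynomial ℤ :=
  ∑ᶠ (c : ι) (_ : f c ≠ 0), (w c : ℤ) • LaurentPolynomial.T (f c)

/-- The writhe polynomial `∑_{Ind(c) ≠ 0} w(c) t ^ Ind(c)`. -/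
noncomputable def GaussDiagram.writhePolynomial (G : GaussDiagram) : LaurentPolynomial ℤ :=
  writheSum G.sign G.ind

/-! ### Knot diagrams and colorings -/

namespace ThickenedKnot

variable {S : Type u} [TopologicalSpace S] [ChartedSpace Plane S] (K : ThickenedKnot S)

/-- The projection of the knot to the surface is a knot diagram: an immersed curve whose only
multiple points are finitely many transverse double points. -/
structure IsRegular : Prop where
  immersed : ∀ θ, velocity K.proj.toFun θ ≠ 0
  transverse : ∀ θ θ', θ ≠ θ' → K.proj.toFun θ = K.proj.toFun θ' →
    tangentArea K.proj.toFun K.proj.toFun θ θ' ≠ 0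
  no_triple : ∀ θ₁ θ₂ θ₃, K.proj.toFun θ₁ = K.proj.toFun θ₂ →
    K.proj.toFun θ₂ = K.proj.toFun θ₃ → θ₁ = θ₂ ∨ θ₂ = θ₃ ∨ θ₁ = θ₃
  finite : {p : UnitAddCircle × UnitAddCircle |
    p.1 ≠ p.2 ∧ K.proj.toFun p.1 = K.proj.toFun p.2}.Finite

/-- A crossing point of the diagram, given by the parameters of the overcrossing and of the
undercrossing. -/
@[ext]
structure Crossing where
  overParam : UnitAddCircle
  underParam : UnitAddCircle
  proj_eq : K.proj.toFun overParam = K.proj.toFun underParam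
  under_lt_over : K.height underParam < K.height overParam

variable {K}

theorem Crossing.over_ne_under (c : K.Crossing) : c.overParam ≠ c.underParam := fun h => by
  have := c.under_lt_over
  rw [h] at this
  exact lt_irrefl _ this

/-- The writhe of a crossing point: `+1` if the tangent vectors of the over-arc and of the
under-arc, in this order, form a positively oriented pair, and `-1` otherwise. -/
noncomputable def Crossing.writhe (c : K.Crossing) : ℤˣ :=
  if 0 < tangentArea K.proj.toFun K.proj.toFun c.overParam c.underParam then 1 else -1

theorem IsRegular.finite_crossing (hK : K.IsRegular) : Finite K.Crossing := by
  have := hK.finite.to_subtype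
  refine Finite.of_injective (fun c : K.Crossing =>
    (⟨(c.overParam, c.underParam), c.over_ne_under, c.proj_eq⟩ : {p : UnitAddCircle × UnitAddCircle |
      p.1 ≠ p.2 ∧ K.proj.toFun p.1 = K.proj.toFun p.2})) fun c c' h => ?_
  have h' := congrArg Subtype.val h
  exact Crossing.ext (congrArg Prod.fst h') (congrArg Prod.snd h')

theorem IsRegular.endpoints_injective (hK : K.IsRegular) :
    Function.Injective (Sum.elim (fun c : K.Crossing => c.overParam) fun c : K.Crossing => c.underParam) := by
  rintro (c | c) (c' | c') h <;> simp only [Sum.elim_inl, Sum.elim_inr] at h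
  · rcases hK.no_triple c.underParam c.overParam c'.underParam c.proj_eq.symm (h ▸ c'.proj_eq) with h1 | h1 | h1
    · exact absurd h1.symm c.over_ne_under
    · exact absurd (h ▸ h1) c'.over_ne_under
    · exact congrArg _ (Crossing.ext h h1)
  · have h1 := c.under_lt_over
    have h2 := c'.under_lt_over
    rcases hK.no_triple c.underParam c.overParam c'.overParam c.proj_eq.symm
      (by rw [h]; exact c'.proj_eq.symm) with h3 | h3 | h3
    · exact absurd h3.symm c.over_ne_under
    · exact absurd (h3.symm.trans h) c'.over_ne_under
    · rw [h] at h1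
      rw [h3] at h1
      exact absurd h1 (lt_asymm h2)
  · have h1 := c.under_lt_over
    have h2 := c'.under_lt_over
    rcases hK.no_triple c.overParam c.underParam c'.underParam c.proj_eq
      (by rw [h]; exact c'.proj_eq) with h3 | h3 | h3
    · exact absurd h3 c.over_ne_under
    · exact absurd (h.symm.trans h3) c'.over_ne_under
    · rw [h, h3] at h1
      exact absurd h1 (lt_asymm h2)
  · rcases hK.no_triple c.overParam c.underParam c'.overParam c.proj_eq (h ▸ c'.proj_eq.symm) with h1 | h1 | h1
    · exact absurd h1 c.over_ne_under
    · exact absurd (h1.symm.trans h) c'.over_ne_under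
    · exact congrArg _ (Crossing.ext h1 h)

/-- The Gauss diagram of a knot diagram: one chord for each crossing point, directed from the
overcrossing to the undercrossing, its sign being the writhe of the crossing point. -/
noncomputable def gaussDiagram (K : ThickenedKnot S) (hK : K.IsRegular) : GaussDiagram where
  Chord := K.Crossing
  finite := hK.finite_crossing
  tail c := c.overParam
  head c := c.underParam
  sign c := c.writhe
  endpoints_injective := hK.endpoints_injective

variable (K)

/-- The closed curve `γ` is in general position to the diagram of `K`: it meets it transversally
and does not pass through its crossing points. -/
structure IsGeneric (γ : ClosedCurve S) : Prop where
  transverse : ∀ s θ, γ.toFun s = K.proj.toFun θ →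
    tangentArea γ.toFun K.proj.toFun s θ ≠ 0
  avoids : ∀ (c : K.Crossing) (s : UnitAddCircle), γ.toFun s ≠ K.proj.toFun c.overParam

/-- The total sign of the intersection points of the diagram `D` of `K` with `γ` at the
parameter `θ` of `D`. A passage of `γ` through this point counts `+1` if the tangent vectors of
`D` and of `γ`, in this order, form a positively oriented pair, and `-1` if they form a negatively
oriented pair. -/
noncomputable def jump (γ : ClosedCurve S) (θ : UnitAddCircle) : ℤ :=
  ∑ᶠ (s : UnitAddCircle) (_ : γ.toFun s = K.proj.toFun θ),
    (SignType.sign (tangentArea K.proj.toFun γ.toFun θ s) : ℤ)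

/-- A coloring of the diagram of `K` with respect to `γ`: an integer on each of the parts into
which `γ` divides the diagram, that is, a function that is locally constant away from the
intersection points with `γ` and that, when one walks along the diagram through an intersection
point, increases by the sign of this point. (The values at the intersection points themselves are
irrelevant.) -/
structure IsColoring (γ : ClosedCurve S) (χ : UnitAddCircle → ℤ) : Prop where
  locally_constant : ∀ θ, K.proj.toFun θ ∉ Set.range γ.toFun → ∀ᶠ θ' in 𝓝 θ, χ θ' = χ θ
  jumps : ∀ θ, K.proj.toFun θ ∈ Set.range γ.toFun → ∃ a : ℤ,
    (∀ᶠ r : ℝ in 𝓝[<] 0, χ (θ + (r : UnitAddCircle)) = a) ∧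
    ∀ᶠ r : ℝ in 𝓝[>] 0, χ (θ + (r : UnitAddCircle)) = a + K.jump γ θ

variable {K}

/-- The chord index `f_γ(c)` computed from a coloring `χ` with respect to `γ`: the integer on the
over-arc minus the integer on the under-arc at the crossing point `c`. -/
def chordIndex (χ : UnitAddCircle → ℤ) (c : K.Crossing) : ℤ := χ c.overParam - χ c.underParam

variable (K)

/-- The writhe polynomial `∑_{f_γ(c) ≠ 0} w(c) t ^ f_γ(c)` of `K` with respect to `γ`, computed
from a coloring `χ` with respect to `γ`. -/
noncomputable def writhePolynomial (χ : UnitAddCircle → ℤ) : LaurentPolynomial ℤ :=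
  writheSum (fun c : K.Crossing => c.writhe) fun c => chordIndex χ c

end ThickenedKnot

/-!
The proof compares two closed curves through maps of the surface to the circle. A map
`g : S → ℝ/ℤ` gives a singular cocycle, the lifted increment of `g` along a singular edge
(`angleCochain`), so the degree of `g` along a closed curve depends only on the homology class of
the curve (`angleCochain_loopSimplex_eq`).

Maps to the circle come from weights on the diagram `D` of `K`. Call an integer weight `n` on the
parameter circle of `D` balanced (`IsBalanced`) if it is constant away from the crossings and if at
each crossing as much weight flows in as flows out. In a chart in which `D` is one coordinate axis
or both (`exists_adaptedChart`, `LocalModel`), a balanced weight is the jump of an integer-valued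
step function on the complement of `D` (`LocalModel.step`); two such local step functions differ by
locally constant functions near the points where both are defined. Averaging them with a partition
of unity gives a function that is well defined and continuous modulo `ℤ` (`exists_map_to_circle`).
Its degree along a closed curve transverse to `D` is the weighted intersection number with `D`, up
to a factor `-2`, and its degree along `D` itself is the analogous weighted self-intersection number,
in which each crossing is counted once for either branch (`exists_circle_map`). Step functions
along `D` take the mean value of the two sides, and the factor `2` keeps all values integral. Hence
the two numbers agree if the curve is homologous to `D` (`sum_meets_eq_sum_selfMeets`).

Two weights matter. The weight `1` has self-intersection number zero by antisymmetry, so the signs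
of the intersections of `D` with `γ` add up to zero, which is exactly the condition for a coloring
to exist (`exists_isColoring`). For a crossing `c`, the weight that is `1` on the arc of the circle
from the undercrossing to the overcrossing and `-1` on the other arc (`arcWeight`) is balanced. Its
self-intersection number is `2 * Ind(c)` (`GaussDiagram.two_mul_ind`), and since the signs have
total zero, its intersection number with `γ` is twice the sum of the jumps of any coloring on the
first arc, that is, `2 * f_γ(c)` (`ThickenedKnot.IsColoring.chordIndex_eq`).
-/

/-! ### The degree of a map to the circle on homology classes -/

section Degree

open CategoryTheory AlgebraicTopology Simplicial

theorem exists_lift_of_stdSimplex {n : ℕ} (f : C(stdSimplex ℝ (Fin (n + 1)), UnitAddCircle)) :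
    ∃ F : C(stdSimplex ℝ (Fin (n + 1)), ℝ), ∀ x, (F x : UnitAddCircle) = f x := by
  have : LocallyPathConnectedSpace (stdSimplex ℝ (Fin (n + 1))) :=
    (convex_stdSimplex ℝ (Fin (n + 1))).locallyPathConnectedSpace
  have : ContractibleSpace (stdSimplex ℝ (Fin (n + 1))) :=
    (convex_stdSimplex ℝ (Fin (n + 1))).contractibleSpace
      ⟨_, (stdSimplex.vertex (S := ℝ) (0 : Fin (n + 1))).2⟩
  obtain ⟨e₀, he₀⟩ := QuotientAddGroup.mk_surjective (f (stdSimplex.vertex 0))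
  obtain ⟨F, ⟨-, hF⟩, -⟩ := (AddCircle.isCoveringMap_coe (1 : ℝ)).existsUnique_continuousMap_lifts
    f (stdSimplex.vertex 0) e₀ he₀
  exact ⟨F, fun x => congrFun hF x⟩

/-- The total angle, in turns, of a path in `ℝ/ℤ` parametrized by the standard 1-simplex: the
increment of any continuous lift to `ℝ`. -/
noncomputable def angle (f : C(stdSimplex ℝ (Fin 2), UnitAddCircle)) : ℝ :=
  (exists_lift_of_stdSimplex f).choose (stdSimplex.vertex 1) -
    (exists_lift_of_stdSimplex f).choose (stdSimplex.vertex 0)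

/-- An integer-valued continuous function on a preconnected space is constant. -/
theorem eq_of_continuous_of_forall_int {A : Type*} [TopologicalSpace A] [PreconnectedSpace A]
    {f : A → ℝ} (hf : Continuous f) (hint : ∀ x, ∃ n : ℤ, f x = n) (x y : A) : f x = f y := by
  choose n hn using hint
  have hloc : IsLocallyConstant n := by
    refine (IsLocallyConstant.iff_eventually_eq n).2 fun x => ?_
    have := (Metric.continuous_iff'.1 hf) x (1 / 2) (by norm_num)
    filter_upwards [this] with y hy
    rw [hn, hn, Real.dist_eq, ← Int.cast_sub, ← Int.cast_abs] at hy
    by_contra hne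
    have h1 : (1 : ℤ) ≤ |n y - n x| := Int.one_le_abs (sub_ne_zero.2 hne)
    have h2 : (1 : ℝ) ≤ ((|n y - n x| : ℤ) : ℝ) := by exact_mod_cast h1
    linarith
  rw [hn, hn, hloc.apply_eq_of_preconnectedSpace x y]

theorem exists_int_of_coe_eq {a b : ℝ} (h : (a : UnitAddCircle) = b) : ∃ n : ℤ, b - a = n := by
  obtain ⟨n, hn⟩ := (QuotientAddGroup.eq_iff_sub_mem.1 h.symm)
  exact ⟨n, by simpa using hn.symm⟩

theorem angle_eq {f : C(stdSimplex ℝ (Fin 2), UnitAddCircle)} {F : stdSimplex ℝ (Fin 2) → ℝ}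
    (hF : Continuous F) (h : ∀ x, (F x : UnitAddCircle) = f x) :
    angle f = F (stdSimplex.vertex 1) - F (stdSimplex.vertex 0) := by
  have hs := (exists_lift_of_stdSimplex f).choose_spec
  have := eq_of_continuous_of_forall_int
    ((exists_lift_of_stdSimplex f).choose.continuous.sub hF)
    (fun x => exists_int_of_coe_eq ((h x).trans (hs x).symm))
    (stdSimplex.vertex 1) (stdSimplex.vertex 0)
  simp only [Pi.sub_apply] at this
  rw [angle]
  linarith

variable {X : Type u} [TopologicalSpace X]

/-- The singular 1-cochain that sends a path to the total angle of its image under `g`. -/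
noncomputable def angleCochain (g : C(X, UnitAddCircle))
    (σ : (TopCat.toSSet.obj (TopCat.of X)) _⦋1⦌) : ℝ :=
  angle (g.comp (TopCat.toSSetObjEquiv (TopCat.of X) (.op ⦋1⦌) σ))

theorem angleCochain_cocycle (g : C(X, UnitAddCircle))
    (τ : (TopCat.toSSet.obj (TopCat.of X)) _⦋2⦌) :
    angleCochain g ((TopCat.toSSet.obj (TopCat.of X)).δ 0 τ) -
      angleCochain g ((TopCat.toSSet.obj (TopCat.of X)).δ 1 τ) +
      angleCochain g ((TopCat.toSSet.obj (TopCat.of X)).δ 2 τ) = 0 := by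
  obtain ⟨F, hF⟩ := exists_lift_of_stdSimplex
    (g.comp (TopCat.toSSetObjEquiv (TopCat.of X) (.op ⦋2⦌) τ))
  have key : ∀ i : Fin 3, angleCochain g ((TopCat.toSSet.obj (TopCat.of X)).δ i τ) =
      F (stdSimplex.vertex (i.succAbove 1)) - F (stdSimplex.vertex (i.succAbove 0)) := by
    intro i
    rw [angleCochain, angle_eq (F := fun z => F (stdSimplex.map i.succAbove z))
      (F.continuous.comp (stdSimplex.continuous_map _))]
    · simp only [stdSimplex.map_vertex]
    · intro x
      exact hF _
  rw [key, key, key]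
  have e0 : (0 : Fin 3).succAbove (1 : Fin 2) = 2 := rfl
  have e1 : (0 : Fin 3).succAbove (0 : Fin 2) = 1 := rfl
  have e2 : (1 : Fin 3).succAbove (1 : Fin 2) = 2 := rfl
  have e3 : (1 : Fin 3).succAbove (0 : Fin 2) = 0 := rfl
  have e4 : (2 : Fin 3).succAbove (1 : Fin 2) = 1 := rfl
  have e5 : (2 : Fin 3).succAbove (0 : Fin 2) = 0 := rfl
  rw [e0, e1, e2, e3, e4, e5]
  ring

/-- Multiplication by a real number `r`, as a morphism from the coefficient group to `ℝ`. -/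
noncomputable def coeffMul (r : ℝ) :
    ModuleCat.of ℤ (ULift.{u} ℤ) ⟶ ModuleCat.of ℤ (ULift.{u} ℝ) :=
  ModuleCat.ofHom
    { toFun := fun n => ULift.up (n.down * r)
      map_add' := fun a b => ULift.ext _ _ (by simp [add_mul])
      map_smul' := fun a b => ULift.ext _ _ (by simp [mul_assoc]) }

theorem coeffMul_apply_one (r : ℝ) :
    (coeffMul.{u} r).hom (ULift.up 1) = ULift.up r := by
  refine ULift.ext _ _ ?_
  change ((1 : ℤ) : ℝ) * r = r
  simp

theorem coeffMul_comb {a b c : ℝ} (h : a - b + c = 0) :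
    coeffMul.{u} a - coeffMul.{u} b + coeffMul.{u} c = 0 := by
  ext x
  change (x.down : ℝ) * a - x.down * b + x.down * c = 0
  linear_combination (x.down : ℝ) * h

/-- The homomorphism from 1-chains to `ℝ` given by `angleCochain g`. -/
noncomputable def angleHom (g : C(X, UnitAddCircle)) :
    ((TopCat.toSSet.obj (TopCat.of X)).chainComplex (ModuleCat.of ℤ (ULift.{u} ℤ))).X 1 ⟶
      ModuleCat.of ℤ (ULift.{u} ℝ) :=
  Limits.Sigma.desc fun σ => coeffMul (angleCochain g σ)

theorem ι_angleHom (g : C(X, UnitAddCircle)) (σ : (TopCat.toSSet.obj (TopCat.of X)) _⦋1⦌) :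
    (TopCat.toSSet.obj (TopCat.of X)).ιChainComplex σ ≫ angleHom g =
      coeffMul (angleCochain g σ) :=
  Limits.Sigma.ι_desc _ _

theorem d_angleHom (g : C(X, UnitAddCircle)) :
    ((TopCat.toSSet.obj (TopCat.of X)).chainComplex (ModuleCat.of ℤ (ULift.{u} ℤ))).d 2 1 ≫
      angleHom g = 0 := by
  refine SSet.chainComplex_hom_ext fun τ => ?_
  rw [SSet.ιChainComplex_d_assoc]
  refine (congrArg (· ≫ angleHom g) (Fin.sum_univ_three _)).trans ?_
  have := coeffMul_comb.{u} (angleCochain_cocycle g τ)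
  simpa [ι_angleHom, Preadditive.add_comp, ← sub_eq_add_neg] using this

/-- Homologous closed curves have the same degree under every map to the circle: the degree is
the value of the singular cocycle `angleCochain g` on the cycle `loopSimplex β`. -/
theorem angleCochain_loopSimplex_eq (g : C(X, UnitAddCircle)) {β β' : C(UnitAddCircle, X)}
    (h : loopClass β = loopClass β') :
    angleCochain g (loopSimplex β) = angleCochain g (loopSimplex β') := by
  have key : ∀ β : C(UnitAddCircle, X),
      ((((TopCat.toSSet.obj (TopCat.of X)).chainComplex
        (ModuleCat.of ℤ (ULift.{u} ℤ))).homologyι 1 ≫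
        HomologicalComplex.descOpcycles _ (angleHom g) 2 (by simp) (d_angleHom g))).hom
          (loopClass β) = ULift.up (angleCochain g (loopSimplex β)) := by
    intro β
    rw [loopClass, ← coeffMul_apply_one, ← ι_angleHom, ← LinearMap.comp_apply,
      ← ModuleCat.hom_comp]
    congr 2
    simp
  have := (key β).symm.trans ((congrArg _ h).trans (key β'))
  exact congrArg ULift.down this

/-- If `G` is a lift to `ℝ` of the map `g ∘ β` on the circle, the cocycle of `g` evaluates on `β`
to the increment of `G` over a period. -/
theorem angleCochain_loopSimplex (g : C(X, UnitAddCircle)) (β : C(UnitAddCircle, X))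
    {G : ℝ → ℝ} (hG : Continuous G) (h : ∀ t : ℝ, (G t : UnitAddCircle) = g (β t)) :
    angleCochain g (loopSimplex β) = G 1 - G 0 := by
  rw [angleCochain, angle_eq (F := fun x => G (x.1 1))
    (hG.comp ((continuous_apply _).comp continuous_subtype_val))]
  · simp
  · intro x
    rw [h, loopSimplex, Equiv.apply_symm_apply]
    rfl

end Degree

/-! ### Step functions on the line and their jumps -/

section Jumps

open Filter

/-- `F` is constant to the left and to the right of `t`, and jumps by `j` at `t`. The value at `t`
itself is irrelevant. -/
def HasJump (F : ℝ → ℝ) (t j : ℝ) : Prop :=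
  ∃ a, (∀ᶠ r in 𝓝[<] t, F r = a) ∧ ∀ᶠ r in 𝓝[>] t, F r = a + j

theorem hasJump_zero_iff {F : ℝ → ℝ} {t : ℝ} :
    HasJump F t 0 ↔ ∃ a, ∀ᶠ r in 𝓝[≠] t, F r = a := by
  simp only [HasJump, add_zero, ← eventually_sup, punctured_nhds_eq_nhdsWithin_sup_nhdsWithin]

theorem HasJump.add {F G : ℝ → ℝ} {t i j : ℝ} (hF : HasJump F t i) (hG : HasJump G t j) :
    HasJump (fun r => F r + G r) t (i + j) := by
  obtain ⟨a, h1, h2⟩ := hF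
  obtain ⟨b, h3, h4⟩ := hG
  refine ⟨a + b, ?_, ?_⟩
  · filter_upwards [h1, h3] with r e e'
    rw [e, e']
  · filter_upwards [h2, h4] with r e e'
    rw [e, e']
    ring

theorem HasJump.const_mul {F : ℝ → ℝ} {t j : ℝ} (c : ℝ) (hF : HasJump F t j) :
    HasJump (fun r => c * F r) t (c * j) := by
  obtain ⟨a, h1, h2⟩ := hF
  refine ⟨c * a, ?_, ?_⟩
  · filter_upwards [h1] with r e
    rw [e]
  · filter_upwards [h2] with r e
    rw [e]
    ring

theorem hasJump_sum {ι : Type*} (s : Finset ι) {F : ι → ℝ → ℝ} {t : ℝ} {j : ι → ℝ}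
    (h : ∀ i ∈ s, HasJump (F i) t (j i)) :
    HasJump (fun r => ∑ i ∈ s, F i r) t (∑ i ∈ s, j i) := by
  classical
  induction s using Finset.induction_on with
  | empty => exact ⟨0, by simp, by simp⟩
  | insert a s ha ih =>
    simp only [Finset.sum_insert ha]
    exact (h a (Finset.mem_insert_self a s)).add
      (ih fun i hi => h i (Finset.mem_insert_of_mem hi))

theorem HasJump.congr {F G : ℝ → ℝ} {t j : ℝ} (hF : HasJump F t j)
    (h : ∀ᶠ r in 𝓝[≠] t, G r = F r) : HasJump G t j := by
  obtain ⟨a, h1, h2⟩ := hF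
  rw [punctured_nhds_eq_nhdsWithin_sup_nhdsWithin, eventually_sup] at h
  refine ⟨a, ?_, ?_⟩
  · filter_upwards [h1, h.1] with r e e'
    rw [e', e]
  · filter_upwards [h2, h.2] with r e e'
    rw [e', e]

theorem HasJump.unique {F : ℝ → ℝ} {t i j : ℝ} (hF : HasJump F t i) (hG : HasJump F t j) :
    i = j := by
  obtain ⟨a, h1, h2⟩ := hF
  obtain ⟨b, h3, h4⟩ := hG
  obtain ⟨r, e, e'⟩ := (h1.and h3).exists
  obtain ⟨r', f, f'⟩ := (h2.and h4).exists
  linarith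

theorem map_add_right_nhdsLT (t : ℝ) : map (fun r => t + r) (𝓝[<] 0) = 𝓝[<] t := by
  simp

theorem map_add_right_nhdsGT (t : ℝ) : map (fun r => t + r) (𝓝[>] 0) = 𝓝[>] t := by
  simp

theorem hasJump_add_left_iff {F : ℝ → ℝ} {t j : ℝ} :
    HasJump (fun r => F (t + r)) 0 j ↔ HasJump F t j := by
  simp only [HasJump, ← map_add_right_nhdsLT t, ← map_add_right_nhdsGT t, eventually_map]

/-- A step function without jumps is constant. -/
theorem exists_eventually_eq_of_hasJump_zero {F : ℝ → ℝ} (h : ∀ t, HasJump F t 0) :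
    ∃ c, ∀ t, ∀ᶠ r in 𝓝[≠] t, F r = c := by
  simp only [hasJump_zero_iff] at h
  choose a ha using h
  have hloc : IsLocallyConstant a := by
    refine (IsLocallyConstant.iff_eventually_eq a).2 fun t => ?_
    have h1 : ∀ᶠ r in 𝓝[≠] t, a r = a t := by
      filter_upwards [eventually_eventually_nhdsWithin.2 (ha t), self_mem_nhdsWithin] with r hr hrt
      have h2 : ∀ᶠ z in 𝓝 r, F z = a t := by
        rwa [(isOpen_compl_singleton (x := t)).nhdsWithin_eq hrt] at hr
      obtain ⟨z, e, e'⟩ := ((ha r).and (h2.filter_mono nhdsWithin_le_nhds)).exists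
      rw [← e, e']
    rw [eventually_nhdsWithin_iff] at h1
    filter_upwards [h1] with r hr
    by_cases hrt : r = t
    · rw [hrt]
    · exact hr hrt
  exact ⟨a 0, fun t => by
    rw [hloc.apply_eq_of_preconnectedSpace 0 t]
    exact ha t⟩

theorem HasJump.eventually_zero {F : ℝ → ℝ} {j : ℝ → ℝ} (h : ∀ t, HasJump F t (j t)) (t : ℝ) :
    ∀ᶠ r in 𝓝[≠] t, j r = 0 := by
  obtain ⟨a, h1, h2⟩ := h t
  have aux : ∀ {s : Set ℝ} {b : ℝ}, IsOpen s → (∀ᶠ r in 𝓝[s] t, F r = b) →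
      ∀ᶠ r in 𝓝[s] t, j r = 0 := by
    intro s b hs hb
    filter_upwards [eventually_eventually_nhdsWithin.2 hb, self_mem_nhdsWithin] with r hr hrs
    rw [hs.nhdsWithin_eq hrs] at hr
    exact (h r).unique (hasJump_zero_iff.2 ⟨b, hr.filter_mono nhdsWithin_le_nhds⟩)
  rw [punctured_nhds_eq_nhdsWithin_sup_nhdsWithin, eventually_sup]
  exact ⟨aux isOpen_Iio h1, aux isOpen_Ioi h2⟩

theorem eventually_ceil_eq {x : ℝ} (hx : ∀ n : ℤ, x ≠ n) : ∀ᶠ r in 𝓝 x, ⌈r⌉ = ⌈x⌉ := by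
  have h1 : (⌈x⌉ : ℝ) - 1 < x := by linarith [Int.ceil_lt_add_one x]
  have h2 : x < ⌈x⌉ := lt_of_le_of_ne (Int.le_ceil x) (hx _)
  filter_upwards [Ioo_mem_nhds h1 h2] with r hr
  exact Int.ceil_eq_iff.2 ⟨hr.1, hr.2.le⟩

theorem hasJump_ceil (n : ℤ) : HasJump (fun r => (⌈r⌉ : ℝ)) n 1 := by
  refine ⟨n, ?_, ?_⟩
  · filter_upwards [Ioo_mem_nhdsLT (show (n : ℝ) - 1 < n by linarith)] with r hr
    exact_mod_cast Int.ceil_eq_iff.2 ⟨hr.1, hr.2.le⟩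
  · filter_upwards [Ioo_mem_nhdsGT (show (n : ℝ) < n + 1 by linarith)] with r hr
    have : ⌈r⌉ = n + 1 := Int.ceil_eq_iff.2 ⟨by push_cast; linarith [hr.1], by push_cast; exact hr.2.le⟩
    rw [this]
    push_cast
    ring

end Jumps

/-! ### Step functions and the circle -/

section Circle

open Filter

theorem coe_eq_coe_iff_exists_int {a b : ℝ} :
    (a : UnitAddCircle) = b ↔ ∃ n : ℤ, a - b = n := by
  refine ⟨fun h => exists_int_of_coe_eq h.symm, fun ⟨n, hn⟩ => ?_⟩
  rw [eq_add_of_sub_eq hn]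
  simp

/-- The representative in `[0, 1)` of a point of the circle. -/
noncomputable def circleRep (p : UnitAddCircle) : ℝ := (AddCircle.equivIco (1 : ℝ) 0 p : ℝ)

theorem coe_circleRep (p : UnitAddCircle) : (circleRep p : UnitAddCircle) = p :=
  (AddCircle.equivIco (1 : ℝ) 0).symm_apply_apply p

/-- A step function on `ℝ` that jumps by `k p` at all points over `p`, for `p ∈ P`. -/
noncomputable def stairs (P : Finset UnitAddCircle) (k : UnitAddCircle → ℤ) (t : ℝ) : ℤ :=
  ∑ p ∈ P, k p * ⌈t - circleRep p⌉

theorem stairs_add_one (P : Finset UnitAddCircle) (k : UnitAddCircle → ℤ) (t : ℝ) :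
    stairs P k (t + 1) = stairs P k t + ∑ p ∈ P, k p := by
  rw [stairs, stairs, ← Finset.sum_add_distrib]
  refine Finset.sum_congr rfl fun p _ => ?_
  rw [add_sub_right_comm, Int.ceil_add_one]
  ring

theorem stairs_eventually_eq {P : Finset UnitAddCircle} {k : UnitAddCircle → ℤ} {t : ℝ}
    (ht : (t : UnitAddCircle) ∉ P) : ∀ᶠ r in 𝓝 t, stairs P k r = stairs P k t := by
  have : ∀ p ∈ P, ∀ᶠ r in 𝓝 t, ⌈r - circleRep p⌉ = ⌈t - circleRep p⌉ := by
    intro p hp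
    refine (continuous_id.sub continuous_const).continuousAt.eventually
      (eventually_ceil_eq (x := t - circleRep p) fun n hn => ht ?_)
    rw [coe_eq_coe_iff_exists_int.2 ⟨n, hn⟩, coe_circleRep]
    exact hp
  filter_upwards [(Filter.eventually_all_finset P).2 this] with r hr
  exact Finset.sum_congr rfl fun p hp => by rw [hr p hp]

theorem stairs_hasJump {P : Finset UnitAddCircle} {k : UnitAddCircle → ℤ}
    (hP : ∀ p ∉ P, k p = 0) (t : ℝ) :
    HasJump (fun r => (stairs P k r : ℝ)) t (k t) := by
  classical
  have h : ∀ p ∈ P, HasJump (fun r => (k p : ℝ) * ⌈r - circleRep p⌉) t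
      (if p = (t : UnitAddCircle) then k p else 0) := by
    intro p hp
    split_ifs with hpt
    · rw [← coe_circleRep p] at hpt
      obtain ⟨n, hn⟩ := coe_eq_coe_iff_exists_int.1 hpt.symm
      have := hasJump_add_left_iff.2 (hasJump_ceil n)
      rw [← hn] at this
      have h2 : HasJump (fun r : ℝ => (⌈r - circleRep p⌉ : ℝ)) t 1 := by
        refine hasJump_add_left_iff.1 (this.congr (Eventually.of_forall fun r => ?_))
        congr 2
        ring
      simpa using h2.const_mul (k p : ℝ)
    · refine hasJump_zero_iff.2 ⟨k p * ⌈t - circleRep p⌉, ?_⟩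
      have : ∀ᶠ r in 𝓝 t, ⌈r - circleRep p⌉ = ⌈t - circleRep p⌉ :=
        (continuous_id.sub continuous_const).continuousAt.eventually
          (eventually_ceil_eq (x := t - circleRep p) fun n hn => hpt
            (by rw [coe_eq_coe_iff_exists_int.2 ⟨n, hn⟩, coe_circleRep]))
      filter_upwards [this.filter_mono nhdsWithin_le_nhds] with r hr
      rw [hr]
  have := hasJump_sum P h
  convert this using 1
  · funext r
    simp [stairs]
  · rw [Finset.sum_ite_eq']
    split_ifs with h'
    · rfl
    · rw [hP _ h', Int.cast_zero]

/-- The jumps of a step function that is quasi-periodic with period 1 add up to its increment over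
a period. -/
theorem sum_jumps_eq {F : ℝ → ℝ} {d : ℝ} (hF : ∀ t, F (t + 1) = F t + d)
    {P : Finset UnitAddCircle} {k : UnitAddCircle → ℤ} (hP : ∀ p ∉ P, k p = 0)
    (hk : ∀ t : ℝ, HasJump F t (k t)) : d = ∑ p ∈ P, (k p : ℝ) := by
  obtain ⟨c, hc⟩ := exists_eventually_eq_of_hasJump_zero (F := fun r => F r + -1 * stairs P k r)
    fun t => by simpa using (hk t).add ((stairs_hasJump hP t).const_mul (-1))
  have h0 : Tendsto (fun r : ℝ => r + 1) (𝓝[≠] 0) (𝓝[≠] (0 + 1)) :=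
    (tendsto_nhdsWithin_iff.2 ⟨((continuous_add_const 1).tendsto 0).mono_left nhdsWithin_le_nhds,
      eventually_nhdsWithin_of_forall fun r hr h => hr (by simpa using h)⟩)
  obtain ⟨r, h1, h2⟩ := ((hc 0).and (h0.eventually (hc (0 + 1)))).exists
  rw [hF, stairs_add_one] at h2
  push_cast at h2
  linarith

theorem exists_coe_eq_of_mem_Ico (a : ℝ) (p : UnitAddCircle) :
    ∃ q : ℝ, q ∈ Set.Ico a (a + 1) ∧ (q : UnitAddCircle) = p :=
  ⟨AddCircle.equivIco 1 a p, (AddCircle.equivIco 1 a p).2,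
    (AddCircle.equivIco (1 : ℝ) a).symm_apply_apply p⟩

theorem coe_mem_cIoo_iff {a b q : ℝ} (hab : b ∈ Set.Ico a (a + 1)) (hq : q ∈ Set.Ioo a (a + 1)) :
    (q : UnitAddCircle) ∈ Set.cIoo (a : UnitAddCircle) b ↔ q < b := by
  rw [Set.mem_cIoo, sbtw_iff_not_btw, btw_cyclic, QuotientAddGroup.btw_coe_iff, not_le,
    (toIcoMod_eq_self _).2 hab, (toIocMod_eq_self _).2 ⟨hq.1, hq.2.le⟩]

/-- Between two points without jumps, the increment of a step function on the circle is the sum of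
its jumps on the arc between these points. -/
theorem sub_eq_sum_jumps {f : UnitAddCircle → ℝ} {P : Finset UnitAddCircle}
    {k : UnitAddCircle → ℤ} (hP : ∀ p, p ∈ P ↔ k p ≠ 0)
    (hk : ∀ θ : UnitAddCircle, HasJump (fun r : ℝ => f (θ + (r : UnitAddCircle))) 0 (k θ))
    {x y : UnitAddCircle} (hxy : x ≠ y) (hx : ∀ᶠ z in 𝓝 x, f z = f x)
    (hy : ∀ᶠ z in 𝓝 y, f z = f y) [DecidablePred (· ∈ Set.cIoo x y)] :
    f y - f x = ∑ p ∈ P with p ∈ Set.cIoo x y, (k p : ℝ) := by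
  have hk' : ∀ t : ℝ, HasJump (fun r : ℝ => f r) t (k t) := fun t =>
    hasJump_add_left_iff.1 (by simpa using hk t)
  have hP' : ∀ p ∉ P, k p = 0 := fun p hp => not_not.1 fun h => hp ((hP p).2 h)
  obtain ⟨c, hc⟩ := exists_eventually_eq_of_hasJump_zero
    (F := fun r : ℝ => f r + -1 * stairs P k r)
    fun t => by simpa using (hk' t).add ((stairs_hasJump hP' t).const_mul (-1))
  have hval : ∀ t : ℝ, (∀ᶠ z in 𝓝 (t : UnitAddCircle), f z = f t) →
      (t : UnitAddCircle) ∉ P ∧ f t = c + stairs P k t := by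
    intro t ht
    have ht' : ∀ᶠ r : ℝ in 𝓝 t, f r = f t :=
      (AddCircle.continuous_mk' 1).continuousAt.eventually ht
    have hnot : (t : UnitAddCircle) ∉ P := by
      rw [hP, not_not]
      exact_mod_cast (hk' t).unique (hasJump_zero_iff.2
        ⟨f t, ht'.filter_mono nhdsWithin_le_nhds⟩)
    obtain ⟨r, ⟨h1, h2⟩, h3⟩ := (((ht'.and (stairs_eventually_eq hnot)).filter_mono
      nhdsWithin_le_nhds).and (hc t)).exists
    refine ⟨hnot, ?_⟩
    rw [h1, h2] at h3
    linarith
  obtain ⟨a, rfl⟩ := QuotientAddGroup.mk_surjective x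
  obtain ⟨b, hab, rfl⟩ := exists_coe_eq_of_mem_Ico a y
  obtain ⟨hxP, hfx⟩ := hval a hx
  obtain ⟨hyP, hfy⟩ := hval b hy
  have hab' : a < b := lt_of_le_of_ne hab.1 fun h => hxy (by rw [h])
  change f (b : UnitAddCircle) - f (a : UnitAddCircle) = _
  rw [hfx, hfy, stairs, stairs, Finset.sum_filter]
  push_cast
  rw [add_sub_add_left_eq_sub, ← Finset.sum_sub_distrib]
  refine Finset.sum_congr rfl fun p hp => ?_
  rw [← mul_sub]
  obtain ⟨q, hq, rfl⟩ := exists_coe_eq_of_mem_Ico a p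
  obtain ⟨n, hn⟩ := coe_eq_coe_iff_exists_int.1 (coe_circleRep (q : UnitAddCircle))
  have hqa : a < q := lt_of_le_of_ne hq.1 fun h => hxP (by rw [h]; exact hp)
  have hqb : q ≠ b := fun h => hyP (by rw [← h]; exact hp)
  have hmem := coe_mem_cIoo_iff hab ⟨hqa, hq.2⟩
  have e1 : ⌈a - circleRep (q : UnitAddCircle)⌉ = -n := by
    rw [Int.ceil_eq_iff]
    constructor <;> push_cast <;> linarith [hq.2]
  change (q : UnitAddCircle) ∈ Set.cIoo (QuotientAddGroup.mk a) b ↔ q < b at hmem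
  split_ifs with h <;> rw [hmem] at h
  · have e2 : ⌈b - circleRep (q : UnitAddCircle)⌉ = -n + 1 := by
      rw [Int.ceil_eq_iff]
      constructor <;> push_cast <;> linarith [hab.2]
    rw [e1, e2]
    push_cast
    ring
  · have e2 : ⌈b - circleRep (q : UnitAddCircle)⌉ = -n := by
      rw [Int.ceil_eq_iff]
      constructor <;> push_cast <;> linarith [hab', hq.2, not_lt.1 h]
    rw [e1, e2]
    ring

/-- If the prescribed jumps add up to zero, there is a step function on the circle with these
jumps. -/
theorem exists_step_function {P : Finset UnitAddCircle} {k : UnitAddCircle → ℤ}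
    (hP : ∀ p ∉ P, k p = 0) (hsum : ∑ p ∈ P, k p = 0) :
    ∃ f : UnitAddCircle → ℤ, (∀ θ ∉ P, ∀ᶠ z in 𝓝 θ, f z = f θ) ∧
      ∀ θ : UnitAddCircle, ∃ a : ℤ, (∀ᶠ r : ℝ in 𝓝[<] 0, f (θ + (r : UnitAddCircle)) = a) ∧
        ∀ᶠ r : ℝ in 𝓝[>] 0, f (θ + (r : UnitAddCircle)) = a + k θ := by
  have hper : Function.Periodic (stairs P k) 1 := fun t => by rw [stairs_add_one, hsum, add_zero]
  refine ⟨hper.lift, fun θ hθ => ?_, fun θ => ?_⟩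
  · obtain ⟨t, rfl⟩ := QuotientAddGroup.mk_surjective θ
    have := stairs_eventually_eq (k := k) hθ
    rw [QuotientAddGroup.nhds_eq, eventually_map]
    exact this
  · obtain ⟨t, rfl⟩ := QuotientAddGroup.mk_surjective θ
    obtain ⟨a, h1, h2⟩ := hasJump_add_left_iff.2 (stairs_hasJump hP t)
    obtain ⟨r, hr⟩ := h1.exists
    simp only [← hr] at h1 h2
    refine ⟨stairs P k (t + r), ?_, ?_⟩
    · filter_upwards [h1] with z hz
      exact_mod_cast hz
    · filter_upwards [h2] with z hz
      exact_mod_cast hz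

/-- A subset of the circle without accumulation points is finite. -/
theorem finite_of_eventually_notMem {T : Set UnitAddCircle}
    (h : ∀ θ : UnitAddCircle, ∀ᶠ r : ℝ in 𝓝[≠] 0, θ + (r : UnitAddCircle) ∉ T) : T.Finite := by
  have hloc : ∀ θ ∈ (Set.univ : Set UnitAddCircle), ∃ V ∈ 𝓝[Set.univ] θ, (V ∩ T).Finite := by
    intro θ _
    rw [nhdsWithin_univ]
    obtain ⟨t, rfl⟩ := QuotientAddGroup.mk_surjective θ
    have h1 := eventually_nhdsWithin_iff.1 (h (QuotientAddGroup.mk t))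
    have h2 : ∀ᶠ z : ℝ in 𝓝 t, z ≠ t → (z : UnitAddCircle) ∉ T := by
      have : Tendsto (fun z : ℝ => z - t) (𝓝 t) (𝓝 0) := by
        simpa using (continuous_sub_right t).tendsto t
      filter_upwards [this.eventually h1] with z hz hzt
      have := hz (sub_ne_zero.2 hzt)
      rwa [← QuotientAddGroup.mk_add, add_sub_cancel] at this
    refine ⟨(fun z : ℝ => (z : UnitAddCircle)) '' {z | z ≠ t → (z : UnitAddCircle) ∉ T}, ?_, ?_⟩
    · rw [QuotientAddGroup.nhds_eq]
      exact image_mem_map h2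
    · refine (Set.finite_singleton (t : UnitAddCircle)).subset ?_
      rintro _ ⟨⟨z, hz, rfl⟩, hzT⟩
      by_contra hne
      exact hz (fun h => hne (by rw [h]; rfl)) hzT
  obtain ⟨V, hV⟩ := isCompact_univ.elim_nhds_subcover' (fun θ hθ => (hloc θ hθ).choose)
    (fun θ hθ => by simpa using (hloc θ hθ).choose_spec.1)
  refine (Set.Finite.biUnion V.finite_toSet
    (t := fun x => (hloc x.1 x.2).choose ∩ T) fun x _ => (hloc x.1 x.2).choose_spec.2).subset ?_
  intro z hz
  obtain ⟨x, hx, hxz⟩ := Set.mem_iUnion₂.1 (hV (Set.mem_univ z))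
  exact Set.mem_iUnion₂.2 ⟨x, hx, hxz, hz⟩

end Circle

/-! ### From local step functions to a map to the circle -/

section Glue

open Filter

theorem exists_lift_of_real {f : ℝ → UnitAddCircle} (hf : Continuous f) :
    ∃ G : ℝ → ℝ, Continuous G ∧ ∀ t, (G t : UnitAddCircle) = f t := by
  obtain ⟨e₀, he₀⟩ := QuotientAddGroup.mk_surjective (f 0)
  obtain ⟨F, ⟨-, hF⟩, -⟩ := (AddCircle.isCoveringMap_coe (1 : ℝ)).existsUnique_continuousMap_lifts
    ⟨f, hf⟩ 0 e₀ he₀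
  exact ⟨F, F.continuous, fun x => congrFun hF x⟩

theorem eventually_eq_of_continuousAt_of_forall_int {A : Type*} [TopologicalSpace A]
    {f : A → ℝ} {x : A} (hf : ContinuousAt f x) (hint : ∀ y, ∃ n : ℤ, f y = n) :
    ∀ᶠ y in 𝓝 x, f y = f x := by
  choose n hn using hint
  have := (Metric.continuousAt_iff'.1 hf) (1 / 2) (by norm_num)
  filter_upwards [this] with y hy
  rw [hn, hn, Real.dist_eq, ← Int.cast_sub, ← Int.cast_abs] at hy
  rw [hn, hn]
  by_contra hne
  have h1 : (1 : ℤ) ≤ |n y - n x| := Int.one_le_abs (sub_ne_zero.2 fun h => hne (by rw [h]))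
  have h2 : (1 : ℝ) ≤ ((|n y - n x| : ℤ) : ℝ) := by exact_mod_cast h1
  linarith

variable {X : Type u} [TopologicalSpace X]

/-- Let `h p`, for `p : X`, be integer-valued functions that near each point `q` of the
neighbourhood `U p` of `p` agree with `h q` up to a constant. Averaging them by a partition of
unity gives a real function whose class modulo `ℤ` is continuous. Its degree on a closed curve
`β` can be read off from the jumps of the functions `h (β s)` along `β` at the parameters `s`. -/
theorem exists_map_to_circle [T2Space X] [CompactSpace X] {U : X → Set X} {h : X → X → ℤ}
    (hU : ∀ p, IsOpen (U p)) (hmem : ∀ p, p ∈ U p)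
    (hcompat : ∀ p, ∀ q ∈ U p, ∀ᶠ z in 𝓝 q, h p z - h q z = h p q - h q q) :
    ∃ g : C(X, UnitAddCircle), ∀ (β : C(UnitAddCircle, X)) (k : UnitAddCircle → ℤ),
      (∀ s : UnitAddCircle,
        HasJump (fun r : ℝ => h (β s) (β (s + (r : UnitAddCircle)))) 0 (k s)) →
      ∃ P : Finset UnitAddCircle, (∀ s, s ∈ P ↔ k s ≠ 0) ∧
        angleCochain g (loopSimplex β) = -∑ s ∈ P, (k s : ℝ) := by
  classical
  obtain ⟨ρ, hρ⟩ := PartitionOfUnity.exists_isSubordinate (isClosed_univ (X := X)) U hU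
    fun x _ => Set.mem_iUnion.2 ⟨x, hmem x⟩
  set H : X → ℝ := fun z => ∑ᶠ p, ρ p z * (h p z : ℝ) with hH
  -- Near `q` the function `H - h q` is a combination of the constants `h p q - h q q`, with continuous
  -- coefficients that add up to one.
  have hcont : ∀ q, ContinuousAt (fun z => H z - h q z) q := by
    intro q
    have hev : ∀ᶠ z in 𝓝 q, H z - h q z =
        ∑ p ∈ ρ.fintsupport q, ρ p z * ((h p q - h q q : ℤ) : ℝ) := by
      have h1 : ∀ p ∈ ρ.fintsupport q, ∀ᶠ z in 𝓝 q, h p z - h q z = h p q - h q q :=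
        fun p hp => hcompat p q (hρ p ((ρ.mem_fintsupport_iff q p).1 hp))
      filter_upwards [(Filter.eventually_all_finset _).2 h1, ρ.eventually_finsupport_subset q]
        with z hz hsub
      have h2 : H z = ∑ p ∈ ρ.fintsupport q, ρ p z * (h p z : ℝ) := by
        refine finsum_eq_sum_of_support_subset _ fun p hp => hsub ?_
        rw [ρ.mem_finsupport]
        exact fun h0 => hp (mul_eq_zero_of_left h0 _)
      have h3 := ρ.sum_finsupport' (Set.mem_univ z) hsub
      rw [h2]
      calc _ = ∑ p ∈ ρ.fintsupport q, ρ p z * (h p z : ℝ) -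
            (∑ p ∈ ρ.fintsupport q, ρ p z) * h q z := by rw [h3, one_mul]
        _ = _ := by
          rw [Finset.sum_mul, ← Finset.sum_sub_distrib]
          refine Finset.sum_congr rfl fun p hp => ?_
          rw [← hz p hp]
          push_cast
          ring
    refine ContinuousAt.congr (f := fun z => ∑ p ∈ ρ.fintsupport q,
      ρ p z * ((h p q - h q q : ℤ) : ℝ)) ?_ (hev.mono fun z hz => hz.symm)
    exact (continuous_finsetSum _ fun p _ =>
      (ρ p).continuous.mul continuous_const).continuousAt
  have hg : Continuous fun z => (H z : UnitAddCircle) := by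
    refine continuous_iff_continuousAt.2 fun q => ?_
    have h1 : (fun z => (H z : UnitAddCircle)) =
        fun z => ((H z - h q z : ℝ) : UnitAddCircle) := by
      funext z
      exact coe_eq_coe_iff_exists_int.2 ⟨h q z, by ring⟩
    rw [h1]
    exact (AddCircle.continuous_mk' 1).continuousAt.comp (hcont q)
  refine ⟨⟨_, hg⟩, fun β k hk => ?_⟩
  obtain ⟨G, hG, hGg⟩ := exists_lift_of_real (f := fun t : ℝ => (H (β t) : UnitAddCircle))
    (hg.comp (β.continuous.comp (AddCircle.continuous_mk' 1)))
  rw [angleCochain_loopSimplex ⟨_, hg⟩ β hG hGg]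
  -- The lift `G` is quasi-periodic with increment the degree, and `H ∘ β` is periodic.
  have hF : ∀ t : ℝ, G (t + 1) - H (β (t + 1 : ℝ)) = G t - H (β t) + (G 1 - G 0) := by
    intro t
    have hper : ∀ t : ℝ, ((t + 1 : ℝ) : UnitAddCircle) = t := fun t => by simp
    have := eq_of_continuous_of_forall_int (f := fun t => G (t + 1) - G t)
      ((hG.comp (continuous_add_const 1)).sub hG)
      (fun t => exists_int_of_coe_eq (by rw [hGg, hGg, hper])) t 0
    simp only [zero_add] at this
    rw [hper]
    linarith
  -- The function `G - (H - h (β t)) ∘ β` is integer-valued and continuous at `t`, so that near `t` the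
  -- integer-valued function `G - H ∘ β` is a constant minus `h (β t) ∘ β`.
  have hjump : ∀ t : ℝ, HasJump (fun r : ℝ => G r - H (β r)) t ((-k t : ℤ) : ℝ) := by
    intro t
    have hcontt : ContinuousAt (fun r : ℝ => G r - (H (β r) - h (β t) (β r))) t := by
      refine hG.continuousAt.sub (ContinuousAt.comp (f := fun r : ℝ => β r)
        (g := fun z => H z - h (β t) z) (hcont (β t)) ?_)
      exact (β.continuous.comp (AddCircle.continuous_mk' 1)).continuousAt
    have hconst := eventually_eq_of_continuousAt_of_forall_int hcontt fun r => by
      obtain ⟨n, hn⟩ := coe_eq_coe_iff_exists_int.1 (hGg r)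
      exact ⟨n + h (β t) (β r), by push_cast; linarith⟩
    have h1 : HasJump (fun r : ℝ => (h (β t) (β r) : ℝ)) t (k t) :=
      hasJump_add_left_iff.1 (by simpa using hk t)
    have h2 := (h1.const_mul (-1)).add (hasJump_zero_iff.2
      ⟨_, hconst.filter_mono nhdsWithin_le_nhds⟩)
    convert h2 using 1
    · funext r
      ring
    · push_cast
      ring
  have hfin : {s | k s ≠ 0}.Finite := by
    refine finite_of_eventually_notMem fun θ => ?_
    obtain ⟨t, rfl⟩ := QuotientAddGroup.mk_surjective θ
    have := HasJump.eventually_zero (j := fun t : ℝ => (k (t : UnitAddCircle) : ℝ))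
      (fun s => by simpa using (hjump s).const_mul (-1)) t
    have h0 : Tendsto (fun r : ℝ => t + r) (𝓝[≠] 0) (𝓝[≠] t) :=
      tendsto_nhdsWithin_iff.2
        ⟨by simpa using ((continuous_const_add t).tendsto 0).mono_left nhdsWithin_le_nhds,
        eventually_nhdsWithin_of_forall fun r hr h => hr (by simpa using h)⟩
    filter_upwards [h0.eventually this] with r hr
    simpa using hr
  refine ⟨hfin.toFinset, by simp, ?_⟩
  rw [sum_jumps_eq (F := fun t : ℝ => G t - H (β t)) hF (P := hfin.toFinset)
    (k := fun s => -k s) (by simp) hjump]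
  simp

end Glue

/-! ### Tangent vectors in oriented charts -/

section Charts

open Filter

theorem area_map (L : Plane →L[ℝ] Plane) (v w : Plane) :
    area (L v) (L w) = L.det * area v w := by
  have hb : ∀ v : Plane, v = v 0 • EuclideanSpace.single 0 1 + v 1 • EuclideanSpace.single 1 1 := by
    intro v
    ext i
    fin_cases i <;> simp
  have hL : ∀ v : Plane, ∀ i, L v i = v 0 * L (EuclideanSpace.single 0 1) i +
      v 1 * L (EuclideanSpace.single 1 1) i := by
    intro v i
    conv_lhs => rw [hb v]
    simp
  have hdet : L.det = L (EuclideanSpace.single 0 1) 0 * L (EuclideanSpace.single 1 1) 1 -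
      L (EuclideanSpace.single 1 1) 0 * L (EuclideanSpace.single 0 1) 1 := by
    rw [ContinuousLinearMap.det, ← LinearMap.det_toMatrix (EuclideanSpace.basisFun (Fin 2) ℝ).toBasis,
      Matrix.det_fin_two]
    simp [LinearMap.toMatrix_apply]
  rw [area, hL v, hL v, hL w, hL w, hdet, area]
  ring

variable {S : Type u} [TopologicalSpace S] [ChartedSpace Plane S]
  {T : Type*} [TopologicalSpace T] [ChartedSpace Plane T]

/-- The derivative of a map between surfaces at a point, with both tangent spaces identified with
the plane by the preferred charts. -/
noncomputable def planeDeriv (f : S → T) (x : S) : Plane →L[ℝ] Plane :=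
  mfderiv (𝓡 2) (𝓡 2) f x

/-- The derivative at the parameter `0` of a curve on a surface, in the preferred chart. -/
noncomputable def curveDeriv (a : ℝ → S) : ℝ →L[ℝ] Plane := mfderiv 𝓘(ℝ, ℝ) (𝓡 2) a 0

/-- The velocity at the parameter `0` of a curve on a surface, in the preferred chart. -/
noncomputable def curveVelocity (a : ℝ → S) : Plane := curveDeriv a 1

theorem hasDerivAt_comp_curve {f : S → Plane} {a : ℝ → S} {q : S} (hq : a 0 = q)
    (hf : MDifferentiableAt (𝓡 2) (𝓡 2) f q) (ha : MDifferentiableAt 𝓘(ℝ, ℝ) (𝓡 2) a 0) :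
    HasDerivAt (fun r => f (a r)) (planeDeriv f q (curveVelocity a)) 0 := by
  subst hq
  have h : HasFDerivAt (fun r => f (a r)) ((planeDeriv f (a 0)).comp (curveDeriv a)) 0 :=
    hasMFDerivAt_iff_hasFDerivAt.1 (hf.hasMFDerivAt.comp 0 ha.hasMFDerivAt)
  exact h.hasDerivAt

theorem hasDerivAt_chart_curve {a : ℝ → S} {q : S} (hq : a 0 = q)
    (ha : MDifferentiableAt 𝓘(ℝ, ℝ) (𝓡 2) a 0) :
    HasDerivAt (fun r => chartAt Plane q (a r)) (curveVelocity a) 0 := by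
  subst hq
  have h : HasFDerivWithinAt (fun r => chartAt Plane (a 0) (a r))
      (curveDeriv a) (Set.range 𝓘(ℝ, ℝ)) 0 := ha.hasMFDerivAt.2
  rw [ModelWithCorners.range_eq_univ, hasFDerivWithinAt_univ] at h
  exact h.hasDerivAt

theorem planeDeriv_symm_chart {e : OpenPartialHomeomorph S Plane} {y : Plane}
    (he : MDifferentiableAt (𝓡 2) (𝓡 2) e.symm y) :
    planeDeriv e.symm y = fderiv ℝ (chartAt Plane (e.symm y) ∘ e.symm) y := by
  have h : HasFDerivWithinAt (chartAt Plane (e.symm y) ∘ e.symm) (planeDeriv e.symm y)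
      (Set.range (𝓡 2)) y := he.hasMFDerivAt.2
  rw [ModelWithCorners.range_eq_univ, hasFDerivWithinAt_univ] at h
  exact h.fderiv.symm

theorem det_planeDeriv_symm_chart_pos [IsManifold (𝓡 2) ∞ S] [OrientedAtlas S] (q : S) {y : Plane}
    (hy : y ∈ (chartAt Plane q).target) : 0 < (planeDeriv (chartAt Plane q).symm y).det := by
  have h1 : ContMDiffAt (𝓡 2) (𝓡 2) ∞ (chartAt Plane q).symm y :=
    contMDiffAt_symm_of_mem_maximalAtlas (IsManifold.chart_mem_maximalAtlas q) hy
  rw [planeDeriv_symm_chart (h1.mdifferentiableAt (by simp))]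
  have := OrientedAtlas.det_pos (S := S) _ (chart_mem_atlas Plane q) _
    (chart_mem_atlas Plane ((chartAt Plane q).symm y)) ((chartAt Plane q).symm y)
    ⟨(chartAt Plane q).map_target hy, mem_chart_source _ _⟩
  rwa [(chartAt Plane q).right_inv hy] at this

theorem planeDeriv_comp {V : Type*} [TopologicalSpace V] [ChartedSpace Plane V]
    {f : S → T} {g : T → V} {x : S} {y : T} (hy : f x = y)
    (hf : MDifferentiableAt (𝓡 2) (𝓡 2) f x) (hg : MDifferentiableAt (𝓡 2) (𝓡 2) g y) :
    planeDeriv (g ∘ f) x = (planeDeriv g y).comp (planeDeriv f x) := by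
  subst hy
  exact mfderiv_comp x hg hf

theorem planeDeriv_eq_fderiv (f : Plane → Plane) (x : Plane) : planeDeriv f x = fderiv ℝ f x :=
  mfderiv_eq_fderiv

theorem det_comp_plane (L M : Plane →L[ℝ] Plane) : (L.comp M).det = L.det * M.det :=
  LinearMap.det_comp _ _

theorem planeDeriv_comp_symm {e : OpenPartialHomeomorph S Plane} {x : S} (hx : x ∈ e.source)
    (he : MDifferentiableAt (𝓡 2) (𝓡 2) e x) (he' : MDifferentiableAt (𝓡 2) (𝓡 2) e.symm (e x)) :
    (planeDeriv e x).comp (planeDeriv e.symm (e x)) = ContinuousLinearMap.id ℝ Plane := by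
  rw [← planeDeriv_comp (e.left_inv hx) he' he, planeDeriv_eq_fderiv]
  have : (e ∘ e.symm) =ᶠ[𝓝 (e x)] id := by
    filter_upwards [e.open_target.mem_nhds (e.map_source hx)] with y hy
    exact e.right_inv hy
  rw [this.fderiv_eq, fderiv_id]

end Charts

/-! ### Coordinates adapted to two transverse curves -/

section Adapted

open Filter

theorem norm_lt_of_abs_lt {z : Plane} {r : ℝ} (h0 : |z 0| < r / 2) (h1 : |z 1| < r / 2) :
    ‖z‖ < r := by
  have hr : 0 < r := by linarith [abs_nonneg (z 0)]
  rw [EuclideanSpace.norm_eq, Real.sqrt_lt' hr, Fin.sum_univ_two, Real.norm_eq_abs,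
    Real.norm_eq_abs]
  nlinarith [abs_nonneg (z 0), abs_nonneg (z 1)]

/-- The linear map of the plane with columns `v` and `w`. -/
noncomputable def columns (v w : Plane) : Plane →L[ℝ] Plane :=
  (EuclideanSpace.proj (0 : Fin 2)).smulRight v + (EuclideanSpace.proj (1 : Fin 2)).smulRight w

theorem det_columns (v w : Plane) : (columns v w).det = area v w := by
  have := area_map (columns v w) !₂[1, 0] !₂[0, 1]
  simpa [columns, area] using this.symm

variable {S : Type u} [TopologicalSpace S] [ChartedSpace Plane S]

/-- Coordinates on an open set of a surface in which the curves `a` and `b` near the parameter `0`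
are the two coordinate axes, parametrized by the coordinate. -/
structure AdaptedChart (a b : ℝ → S) where
  /-- the coordinates, defined on the source of this partial homeomorphism -/
  chart : OpenPartialHomeomorph S Plane
  /-- a bound for the absolute values of the coordinates -/
  radius : ℝ
  /-- `1` if the coordinates preserve the orientation, and `-1` if they reverse it -/
  orient : ℤ
  radius_pos : 0 < radius
  orient_eq : orient = 1 ∨ orient = -1
  contMDiffAt : ∀ x ∈ chart.source, ContMDiffAt (𝓡 2) (𝓡 2) 1 chart x
  contMDiffAt_symm : ∀ x ∈ chart.source, ContMDiffAt (𝓡 2) (𝓡 2) 1 chart.symm (chart x)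
  abs_lt : ∀ x ∈ chart.source, |chart x 0| < radius ∧ |chart x 1| < radius
  fst_axis : ∀ s, |s| < radius → a s ∈ chart.source ∧ chart (a s) = !₂[s, 0]
  snd_axis : ∀ s, |s| < radius → b s ∈ chart.source ∧ chart (b s) = !₂[0, s]
  det_pos : ∀ x ∈ chart.source, 0 < (orient : ℝ) * (planeDeriv chart x).det

/-- The inverse function theorem applied to `(s, t) ↦ a₁ s + b₁ t - φ q` in a chart `φ` at `q`
provides adapted coordinates. -/
theorem exists_adaptedChart [IsManifold (𝓡 2) ∞ S] [OrientedAtlas S] (q : S) {a₁ b₁ : ℝ → Plane}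
    (ha : ContDiffAt ℝ 1 a₁ 0) (hb : ContDiffAt ℝ 1 b₁ 0) (ha0 : a₁ 0 = chartAt Plane q q)
    (hb0 : b₁ 0 = chartAt Plane q q) {v w : Plane} (hv : HasDerivAt a₁ v 0)
    (hw : HasDerivAt b₁ w 0) (hvw : area v w ≠ 0) :
    Nonempty (AdaptedChart (fun s => (chartAt Plane q).symm (a₁ s))
      fun s => (chartAt Plane q).symm (b₁ s)) := by
  set φ := chartAt Plane q with hφ
  set Ψ : Plane → Plane := fun z => a₁ (z 0) + b₁ (z 1) - φ q with hΨ
  have hp : ∀ i : Fin 2, ContDiff ℝ 1 fun z : Plane => z i := fun i =>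
    (EuclideanSpace.proj i : Plane →L[ℝ] ℝ).contDiff
  have hd : ∀ i : Fin 2, HasFDerivAt (fun z : Plane => z i)
      (EuclideanSpace.proj i : Plane →L[ℝ] ℝ) 0 := fun i =>
    (EuclideanSpace.proj i : Plane →L[ℝ] ℝ).hasFDerivAt
  have hΨc : ContDiffAt ℝ 1 Ψ 0 :=
    ((ContDiffAt.comp (g := a₁) (0 : Plane) ha (hp 0).contDiffAt).add
      (ContDiffAt.comp (g := b₁) (0 : Plane) hb (hp 1).contDiffAt)).sub contDiffAt_const
  have hΨd : HasFDerivAt Ψ (columns v w) 0 := by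
    have h1 : HasFDerivAt (fun z : Plane => a₁ (z 0))
        ((EuclideanSpace.proj 0 : Plane →L[ℝ] ℝ).smulRight v) 0 := by
      exact (HasFDerivAt.comp (g := a₁) (0 : Plane) hv.hasFDerivAt (hd 0)).congr_fderiv
        (ContinuousLinearMap.ext fun z => by simp)
    have h2 : HasFDerivAt (fun z : Plane => b₁ (z 1))
        ((EuclideanSpace.proj 1 : Plane →L[ℝ] ℝ).smulRight w) 0 := by
      exact (HasFDerivAt.comp (g := b₁) (0 : Plane) hw.hasFDerivAt (hd 1)).congr_fderiv
        (ContinuousLinearMap.ext fun z => by simp)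
    exact (h1.add h2).sub_const (φ q)
  have hdet : (columns v w).det ≠ 0 := by rwa [det_columns]
  have hΨd' : HasFDerivAt Ψ
      (((columns v w).toContinuousLinearEquivOfDetNeZero hdet : Plane ≃L[ℝ] Plane) :
        Plane →L[ℝ] Plane) 0 := by
    rwa [ContinuousLinearMap.coe_toContinuousLinearEquivOfDetNeZero]
  have hΨ0 : Ψ 0 = φ q := by simp [hΨ, ha0, hb0]
  set Θ := hΨc.toOpenPartialHomeomorph Ψ hΨd' one_ne_zero with hΘ
  have hgood : ∀ᶠ z in 𝓝 (0 : Plane), z ∈ Θ.source ∧ Ψ z ∈ φ.target ∧ ContDiffAt ℝ 1 Ψ z ∧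
      0 < area v w * (fderiv ℝ Ψ z).det := by
    have h1 : ∀ᶠ z in 𝓝 (0 : Plane), z ∈ Θ.source := Θ.open_source.mem_nhds
      (hΨc.mem_toOpenPartialHomeomorph_source hΨd' one_ne_zero)
    refine h1.and (.and ?_ (.and ?_ ?_))
    · refine hΨc.continuousAt.eventually (φ.open_target.mem_nhds ?_)
      rw [hΨ0]
      exact φ.map_source (mem_chart_source _ q)
    · exact hΨc.eventually (by simp)
    · have h1 : ContinuousAt (fun z => area v w * (fderiv ℝ Ψ z).det) 0 :=
        continuousAt_const.mul (ContinuousLinearMap.continuous_det.continuousAt.comp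
          (hΨc.continuousAt_fderiv one_ne_zero))
      refine h1.eventually (lt_mem_nhds ?_)
      change 0 < area v w * (fderiv ℝ Ψ 0).det
      rw [hΨd.fderiv, det_columns]
      exact mul_self_pos.2 hvw
  obtain ⟨r, hr, hball⟩ := Metric.eventually_nhds_iff.1 hgood
  have hbox : ∀ z : Plane, |z 0| < r / 2 → |z 1| < r / 2 → z ∈ Θ.source ∧ Ψ z ∈ φ.target ∧
      ContDiffAt ℝ 1 Ψ z ∧ 0 < area v w * (fderiv ℝ Ψ z).det := fun z h0 h1 =>
    hball (by rw [dist_zero_right]; exact norm_lt_of_abs_lt h0 h1)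
  set E := φ.trans Θ.symm with hE
  set B : Set Plane := {z | |z 0| < r / 2 ∧ |z 1| < r / 2} with hB
  have hBo : IsOpen B := (isOpen_lt (hp 0).continuous.abs continuous_const).inter
    (isOpen_lt (hp 1).continuous.abs continuous_const)
  have hEsrc : ∀ x ∈ E.source, x ∈ φ.source ∧ Ψ (E x) = φ x := fun x hx => by
    rw [hE, OpenPartialHomeomorph.trans_source] at hx
    exact ⟨hx.1, Θ.right_inv hx.2⟩
  have hEz : ∀ z ∈ B, φ.symm (Ψ z) ∈ E.source ∧ E (φ.symm (Ψ z)) = z := fun z hz => by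
    obtain ⟨h1, h2, -, -⟩ := hbox z hz.1 hz.2
    refine ⟨?_, ?_⟩
    · rw [hE, OpenPartialHomeomorph.trans_source]
      refine ⟨φ.map_target h2, ?_⟩
      rw [Set.mem_preimage, φ.right_inv h2]
      exact Θ.map_source h1
    · change Θ.symm (φ (φ.symm (Ψ z))) = z
      rw [φ.right_inv h2]
      exact Θ.left_inv h1
  have hsmooth : ∀ x ∈ E.source, E x ∈ B → ContMDiffAt (𝓡 2) (𝓡 2) 1 E x := fun x hx hxB => by
    obtain ⟨h1, h2, h3, h4⟩ := hbox _ hxB.1 hxB.2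
    have hd : (fderiv ℝ Ψ (E x)).det ≠ 0 := fun h => by simp [h] at h4
    have hsymm : ContDiffAt ℝ 1 Θ.symm (φ x) := by
      have e1 : Θ.symm (φ x) = E x := rfl
      refine Θ.contDiffAt_symm
        (f₀' := (fderiv ℝ Ψ (E x)).toContinuousLinearEquivOfDetNeZero hd) ?_ ?_ (by rw [e1]; exact h3)
      · rw [hE, OpenPartialHomeomorph.trans_source] at hx
        exact hx.2
      · rw [e1, ContinuousLinearMap.coe_toContinuousLinearEquivOfDetNeZero]
        exact (h3.differentiableAt one_ne_zero).hasFDerivAt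
    have hφx : ContMDiffAt (𝓡 2) (𝓡 2) ∞ φ x :=
      contMDiffAt_of_mem_maximalAtlas (IsManifold.chart_mem_maximalAtlas q) (hEsrc x hx).1
    exact ContMDiffAt.comp (g := Θ.symm) (f := φ) x hsymm.contMDiffAt
      (hφx.of_le (show (1 : WithTop ℕ∞) ≤ ∞ by simp))
  have hφsymm : ∀ x ∈ E.source, ContMDiffAt (𝓡 2) (𝓡 2) 1 φ.symm (φ x) := fun x hx => by
    have : ContMDiffAt (𝓡 2) (𝓡 2) ∞ φ.symm (φ x) :=
      contMDiffAt_symm_of_mem_maximalAtlas (IsManifold.chart_mem_maximalAtlas q)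
        (φ.map_source (hEsrc x hx).1)
    exact this.of_le (by simp)
  have hsmooth' : ∀ x ∈ E.source, E x ∈ B → ContMDiffAt (𝓡 2) (𝓡 2) 1 E.symm (E x) :=
    fun x hx hxB => by
      obtain ⟨h1, h2, h3, h4⟩ := hbox _ hxB.1 hxB.2
      refine ContMDiffAt.comp (g := φ.symm) (f := Ψ) (E x) ?_ h3.contMDiffAt
      rw [(hEsrc x hx).2]
      exact hφsymm x hx
  have hdetE : ∀ x ∈ E.source, E x ∈ B → 0 < area v w * (planeDeriv E x).det :=
    fun x hx hxB => by
      obtain ⟨h1, h2, h3, h4⟩ := hbox _ hxB.1 hxB.2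
      have e1 := planeDeriv_comp_symm hx ((hsmooth x hx hxB).mdifferentiableAt (by simp))
        ((hsmooth' x hx hxB).mdifferentiableAt (by simp))
      have e2 : planeDeriv E.symm (E x) = (planeDeriv φ.symm (φ x)).comp (fderiv ℝ Ψ (E x)) := by
        rw [← planeDeriv_eq_fderiv]
        exact planeDeriv_comp (hEsrc x hx).2
          (h3.contMDiffAt.mdifferentiableAt (n := 1) (by simp))
          ((hφsymm x hx).mdifferentiableAt (by simp))
      have e3 := det_planeDeriv_symm_chart_pos q (φ.map_source (hEsrc x hx).1)
      have e4 := congrArg ContinuousLinearMap.det e1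
      rw [det_comp_plane, e2, det_comp_plane] at e4
      have e5 : (ContinuousLinearMap.id ℝ Plane).det = 1 := LinearMap.det_id
      rw [e5] at e4
      change 0 < (planeDeriv φ.symm (φ x)).det at e3
      by_contra hneg
      have h5 := mul_pos e3 h4
      have h6 : (area v w * (planeDeriv E x).det) *
          ((planeDeriv φ.symm (φ x)).det * (area v w * (fderiv ℝ Ψ (E x)).det)) =
          area v w * area v w := by
        linear_combination (area v w * area v w) * e4
      have h7 := mul_self_pos.2 hvw
      rw [← h6] at h7
      exact absurd h7 (not_lt.2 (mul_nonpos_of_nonpos_of_nonneg (not_lt.1 hneg) h5.le))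
  have hmem : ∀ {x}, x ∈ (E.restrOpen _ (E.isOpen_inter_preimage hBo)).source ↔
      x ∈ E.source ∧ E x ∈ B := fun {x} => by
    rw [OpenPartialHomeomorph.restrOpen_source]
    exact ⟨fun h => h.2, fun h => ⟨h.1, h⟩⟩
  have hΨx : ∀ s, Ψ !₂[s, 0] = a₁ s := fun s => by simp [hΨ, hb0]
  have hΨy : ∀ s, Ψ !₂[0, s] = b₁ s := fun s => by simp [hΨ, ha0]
  refine ⟨{
    chart := E.restrOpen _ (E.isOpen_inter_preimage hBo)
    radius := r / 2
    orient := SignType.sign (area v w)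
    radius_pos := half_pos hr
    orient_eq := ?_
    contMDiffAt := fun x hx => hsmooth x (hmem.1 hx).1 (hmem.1 hx).2
    contMDiffAt_symm := fun x hx => hsmooth' x (hmem.1 hx).1 (hmem.1 hx).2
    abs_lt := fun x hx => (hmem.1 hx).2
    fst_axis := fun s hs => ?_
    snd_axis := fun s hs => ?_
    det_pos := fun x hx => ?_ }⟩
  · rcases lt_or_gt_of_ne hvw with h | h
    · right
      simp [sign_neg h]
    · left
      simp [sign_pos h]
  · have hz : !₂[s, 0] ∈ B := ⟨by simpa using hs, by simpa using hr⟩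
    have := hEz _ hz
    rw [hΨx] at this
    exact ⟨hmem.2 ⟨this.1, by rw [this.2]; exact hz⟩, this.2⟩
  · have hz : !₂[0, s] ∈ B := ⟨by simpa using hr, by simpa using hs⟩
    have := hEz _ hz
    rw [hΨy] at this
    exact ⟨hmem.2 ⟨this.1, by rw [this.2]; exact hz⟩, this.2⟩
  · have h := hdetE x (hmem.1 hx).1 (hmem.1 hx).2
    change 0 < _ * (planeDeriv E x).det
    rcases lt_or_gt_of_ne hvw with h' | h'
    · rw [sign_neg h']
      have := neg_of_mul_pos_right h h'.le
      simpa using this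
    · rw [sign_pos h']
      have := pos_of_mul_pos_right h h'.le
      simpa using this

theorem AdaptedChart.mem_source {a b : ℝ → S} (M : AdaptedChart a b) : a 0 ∈ M.chart.source :=
  (M.fst_axis 0 (by simpa using M.radius_pos)).1

theorem AdaptedChart.chart_zero {a b : ℝ → S} (M : AdaptedChart a b) : M.chart (a 0) = 0 := by
  rw [(M.fst_axis 0 (by simpa using M.radius_pos)).2]
  ext i
  fin_cases i <;> simp

/-- Adapted coordinates can be restricted to arbitrarily small neighbourhoods. -/
theorem AdaptedChart.exists_shrink {a b a' b' : ℝ → S} (M : AdaptedChart a b) {O : Set S}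
    (hO : O ∈ 𝓝 (a 0)) {ε : ℝ} (hε : 0 < ε) (ha : ∀ᶠ s in 𝓝 0, a' s = a s)
    (hb : ∀ᶠ s in 𝓝 0, b' s = b s) :
    ∃ M' : AdaptedChart a' b', M'.chart.source ⊆ O ∩ M.chart.source ∧ M'.radius ≤ ε ∧
      ∀ x, M'.chart x = M.chart x := by
  have hs := M.mem_source
  have h0 := M.chart_zero
  have hcont : ContinuousAt M.chart.symm 0 := by
    rw [← h0]
    exact M.chart.continuousAt_symm (M.chart.map_source hs)
  have hO' : ∀ᶠ z in 𝓝 (0 : Plane), M.chart.symm z ∈ O := by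
    refine hcont.eventually ?_
    rwa [← h0, M.chart.left_inv hs]
  obtain ⟨r, hr, hball⟩ := Metric.eventually_nhds_iff.1 hO'
  obtain ⟨r', hr', hball'⟩ := Metric.eventually_nhds_iff.1 (ha.and hb)
  set δ := min (min (r / 2) r') (min ε M.radius) with hδ
  have hδpos : 0 < δ := lt_min (lt_min (half_pos hr) hr') (lt_min hε M.radius_pos)
  have hδ1 : δ ≤ r / 2 := (min_le_left _ _).trans (min_le_left _ _)
  have hδ2 : δ ≤ r' := (min_le_left _ _).trans (min_le_right _ _)
  have hδ3 : δ ≤ ε := (min_le_right _ _).trans (min_le_left _ _)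
  have hδ4 : δ ≤ M.radius := (min_le_right _ _).trans (min_le_right _ _)
  set B : Set Plane := {z | |z 0| < δ ∧ |z 1| < δ} with hB
  have hp : ∀ i : Fin 2, Continuous fun z : Plane => z i := fun i =>
    (EuclideanSpace.proj i : Plane →L[ℝ] ℝ).continuous
  have hBo : IsOpen B := (isOpen_lt (hp 0).abs continuous_const).inter
    (isOpen_lt (hp 1).abs continuous_const)
  have hmem : ∀ {x}, x ∈ (M.chart.restrOpen _ (M.chart.isOpen_inter_preimage hBo)).source ↔
      x ∈ M.chart.source ∧ M.chart x ∈ B := fun {x} => by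
    rw [OpenPartialHomeomorph.restrOpen_source]
    exact ⟨fun h => h.2, fun h => ⟨h.1, h⟩⟩
  have hab : ∀ s, |s| < δ → a' s = a s ∧ b' s = b s := fun s hs =>
    hball' (by rw [dist_zero_right]; exact hs.trans_le hδ2)
  refine ⟨{
    chart := M.chart.restrOpen _ (M.chart.isOpen_inter_preimage hBo)
    radius := δ
    orient := M.orient
    radius_pos := hδpos
    orient_eq := M.orient_eq
    contMDiffAt := fun x hx => M.contMDiffAt x (hmem.1 hx).1
    contMDiffAt_symm := fun x hx => M.contMDiffAt_symm x (hmem.1 hx).1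
    abs_lt := fun x hx => (hmem.1 hx).2
    fst_axis := fun s hs => ?_
    snd_axis := fun s hs => ?_
    det_pos := fun x hx => M.det_pos x (hmem.1 hx).1 }, ?_, hδ3, fun x => rfl⟩
  · obtain ⟨h1, h2⟩ := M.fst_axis s (hs.trans_le hδ4)
    rw [(hab s hs).1]
    refine ⟨hmem.2 ⟨h1, ?_⟩, h2⟩
    rw [h2]
    exact ⟨by simpa using hs, by simpa using hδpos⟩
  · obtain ⟨h1, h2⟩ := M.snd_axis s (hs.trans_le hδ4)
    rw [(hab s hs).2]
    refine ⟨hmem.2 ⟨h1, ?_⟩, h2⟩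
    rw [h2]
    exact ⟨by simpa using hδpos, by simpa using hs⟩
  · intro x hx
    obtain ⟨h1, h2⟩ := hmem.1 hx
    refine ⟨?_, h1⟩
    rw [← M.chart.left_inv h1]
    refine hball ?_
    rw [dist_zero_right]
    exact norm_lt_of_abs_lt (h2.1.trans_le hδ1) (h2.2.trans_le hδ1)

end Adapted

/-! ### Local models of weighted knot diagrams -/

section Local

open Filter

variable {S : Type u} [TopologicalSpace S] [ChartedSpace Plane S]

/-- The sign of a real number, as an integer. -/
noncomputable def sgn (x : ℝ) : ℤ := SignType.sign x

theorem sgn_zero : sgn 0 = 0 := by simp [sgn]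

theorem sgn_of_pos {x : ℝ} (h : 0 < x) : sgn x = 1 := by simp [sgn, sign_pos h]

theorem sgn_of_neg {x : ℝ} (h : x < 0) : sgn x = -1 := by simp [sgn, sign_neg h]

/-- A closed curve near a parameter `θ`, parametrized by the distance from `θ`. -/
def ClosedCurve.branch (γ : ClosedCurve S) (θ : UnitAddCircle) (r : ℝ) : S :=
  γ.toFun (θ + (r : UnitAddCircle))

theorem ClosedCurve.branch_zero (γ : ClosedCurve S) (θ : UnitAddCircle) :
    γ.branch θ 0 = γ.toFun θ := by simp [ClosedCurve.branch]

theorem ClosedCurve.contMDiff_branch (γ : ClosedCurve S) (θ : UnitAddCircle) :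
    ContMDiff 𝓘(ℝ, ℝ) (𝓡 2) ∞ (γ.branch θ) := by
  obtain ⟨t, rfl⟩ := QuotientAddGroup.mk_surjective θ
  have h : ContMDiff 𝓘(ℝ, ℝ) 𝓘(ℝ, ℝ) ∞ fun r : ℝ => t + r :=
    (contDiff_const.add contDiff_id).contMDiff
  exact γ.smooth.comp h

theorem ClosedCurve.mdifferentiableAt_branch (γ : ClosedCurve S) (θ : UnitAddCircle) (r : ℝ) :
    MDifferentiableAt 𝓘(ℝ, ℝ) (𝓡 2) (γ.branch θ) r :=
  (γ.contMDiff_branch θ).mdifferentiableAt (by simp)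

theorem velocity_eq_curveVelocity (γ : ClosedCurve S) (θ : UnitAddCircle) :
    velocity γ.toFun θ = curveVelocity (γ.branch θ) := rfl

/-- A weight on the parameter circle of a knot diagram that is locally constant away from the
crossings, and such that the total weight flowing into a crossing equals the total weight flowing
out of it. At a crossing, the weight of a branch is the mean value of the weights before and after
the crossing. -/
structure IsBalanced (K : ThickenedKnot S) (n : UnitAddCircle → ℤ) : Prop where
  simple : ∀ θ, (∀ θ', K.proj.toFun θ' = K.proj.toFun θ → θ' = θ) →
    ∀ᶠ r : ℝ in 𝓝 0, n (θ + (r : UnitAddCircle)) = n θ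
  double : ∀ θ θ', θ ≠ θ' → K.proj.toFun θ = K.proj.toFun θ' → ∃ δ : ℤ, ∀ᶠ r : ℝ in 𝓝 0,
    n (θ + (r : UnitAddCircle)) = n θ + δ * sgn r ∧
      n (θ' + (r : UnitAddCircle)) = n θ' - δ * sgn r

/-- Coordinates near a point of a knot diagram in which the diagram consists of one axis or both
axes, together with the weights of the branches. -/
structure LocalModel (K : ThickenedKnot S) (n : UnitAddCircle → ℤ) (q : S) where
  /-- the parameter of the branch that is the first axis -/
  θ₁ : UnitAddCircle
  /-- the parameter of the branch that is the second axis, if the point is a crossing -/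
  θ₂ : UnitAddCircle
  /-- the second axis; an arbitrary transversal if the point is not a crossing -/
  transversal : ℝ → S
  /-- the point is a crossing -/
  double : Prop
  coords : AdaptedChart (K.proj.branch θ₁) transversal
  /-- the weight of the first branch -/
  n₁ : ℤ
  /-- the weight of the second branch; `0` if there is none -/
  n₂ : ℤ
  /-- half of the change of weight along the first branch at the crossing -/
  δ : ℤ
  proj_θ₁ : K.proj.toFun θ₁ = q
  eq_of_proj_eq : ¬double → ∀ θ, K.proj.toFun θ = q → θ = θ₁
  ne : double → θ₁ ≠ θ₂
  proj_θ₂ : double → K.proj.toFun θ₂ = q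
  transversal_eq : double → transversal = K.proj.branch θ₂
  weight₁ : ∀ s : ℝ, |s| < coords.radius → n (θ₁ + (s : UnitAddCircle)) = n₁ + δ * sgn s
  weight₂ : double → ∀ s : ℝ, |s| < coords.radius →
    n (θ₂ + (s : UnitAddCircle)) = n₂ - δ * sgn s
  weight_simple : ¬double → n₂ = 0 ∧ δ = 0
  preimage : ∀ θ, K.proj.toFun θ ∈ coords.chart.source →
    (∃ s : ℝ, |s| < coords.radius ∧ θ = θ₁ + (s : UnitAddCircle)) ∨
      double ∧ ∃ s : ℝ, |s| < coords.radius ∧ θ = θ₂ + (s : UnitAddCircle)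

theorem isOpen_arc (θ : UnitAddCircle) (ε : ℝ) :
    IsOpen {z : UnitAddCircle | ∃ s : ℝ, |s| < ε ∧ z = θ + (s : UnitAddCircle)} := by
  have h1 : IsOpenMap fun s : ℝ => θ + (s : UnitAddCircle) :=
    (Homeomorph.addLeft θ).isOpenMap.comp QuotientAddGroup.isOpenMap_coe
  have h2 := h1 _ (isOpen_lt continuous_abs (continuous_const (y := ε)))
  convert h2 using 1
  ext z
  exact ⟨fun ⟨s, hs, h⟩ => ⟨s, hs, h.symm⟩, fun ⟨s, hs, h⟩ => ⟨s, hs, h.symm⟩⟩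

theorem nonempty_localModel_of_chart [T2Space S] {K : ThickenedKnot S} {n : UnitAddCircle → ℤ}
    {q : S} {θ₁ θ₂ : UnitAddCircle} {b b' : ℝ → S} {double : Prop} {a' : ℝ → S}
    (M : AdaptedChart a' b')
    (ha : ∀ᶠ r in 𝓝 0, K.proj.branch θ₁ r = a' r) (hb : ∀ᶠ r in 𝓝 0, b r = b' r) {n₂ δ : ℤ}
    (h₁ : K.proj.toFun θ₁ = q) (hsimple : ¬double → ∀ θ, K.proj.toFun θ = q → θ = θ₁)
    (hdouble : double → ∀ θ, K.proj.toFun θ = q → θ = θ₁ ∨ θ = θ₂)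
    (hne : double → θ₁ ≠ θ₂) (h₂ : double → K.proj.toFun θ₂ = q)
    (hb' : double → b = K.proj.branch θ₂)
    (hw₁ : ∀ᶠ r : ℝ in 𝓝 0, n (θ₁ + (r : UnitAddCircle)) = n θ₁ + δ * sgn r)
    (hw₂ : double → ∀ᶠ r : ℝ in 𝓝 0, n (θ₂ + (r : UnitAddCircle)) = n₂ - δ * sgn r)
    (hw : ¬double → n₂ = 0 ∧ δ = 0) : Nonempty (LocalModel K n q) := by
  obtain ⟨M₁, -, -, -⟩ := M.exists_shrink univ_mem one_pos ha hb
  set V : Set UnitAddCircle :=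
    {z | ∃ s : ℝ, |s| < M₁.radius ∧ z = θ₁ + (s : UnitAddCircle)} ∪
    {z | double ∧ ∃ s : ℝ, |s| < M₁.radius ∧ z = θ₂ + (s : UnitAddCircle)} with hV
  have hVo : IsOpen V := by
    refine (isOpen_arc θ₁ _).union ?_
    by_cases hd : double
    · simpa [hd] using isOpen_arc θ₂ M₁.radius
    · simp [hd]
  -- By compactness, the rest of the diagram stays away from `q`.
  have hO : (K.proj.toFun '' Vᶜ)ᶜ ∈ 𝓝 (K.proj.branch θ₁ 0) := by
    refine ((hVo.isClosed_compl.isCompact.image K.proj.continuous_toFun).isClosed.isOpen_compl).mem_nhds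
      ?_
    rw [K.proj.branch_zero, h₁]
    rintro ⟨θ, hθ, hθq⟩
    refine hθ ?_
    by_cases hd : double
    · rcases hdouble hd θ hθq with rfl | rfl
      · exact Or.inl ⟨0, by simpa using M₁.radius_pos, by simp⟩
      · exact Or.inr ⟨hd, 0, by simpa using M₁.radius_pos, by simp⟩
    · exact Or.inl ⟨0, by simpa using M₁.radius_pos, by simp [hsimple hd θ hθq]⟩
  have hw₂' : ∀ᶠ r : ℝ in 𝓝 0, double → n (θ₂ + (r : UnitAddCircle)) = n₂ - δ * sgn r := by
    by_cases hd : double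
    · simpa [hd] using hw₂ hd
    · simp [hd]
  obtain ⟨ε, hε, hball⟩ := Metric.eventually_nhds_iff.1 (hw₁.and hw₂')
  obtain ⟨M₂, hsub, hrad, heq⟩ := M₁.exists_shrink hO hε
    (Eventually.of_forall fun _ => rfl) (Eventually.of_forall fun _ => rfl)
  have hball' : ∀ s : ℝ, |s| < M₂.radius → _ := fun s hs =>
    hball (y := s) (by rw [dist_zero_right]; exact hs.trans_le hrad)
  refine ⟨⟨θ₁, θ₂, b, double, M₂, n θ₁, n₂, δ, h₁, hsimple, hne, h₂, hb',
    fun s hs => (hball' s hs).1, fun hd s hs => (hball' s hs).2 hd, hw, fun θ hθ => ?_⟩⟩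
  have hθV : θ ∈ V := by
    by_contra h
    exact (hsub hθ).1 ⟨θ, h, rfl⟩
  have habs := M₂.abs_lt _ hθ
  rw [heq] at habs
  rcases hθV with ⟨s, hs, rfl⟩ | ⟨hd, s, hs, rfl⟩
  · have h3 := (M₁.fst_axis s hs).2
    change M₁.chart (K.proj.toFun _) = _ at h3
    rw [h3] at habs
    exact Or.inl ⟨s, by simpa using habs.1, rfl⟩
  · have h3 := (M₁.snd_axis s hs).2
    rw [congrFun (hb' hd) s] at h3
    change M₁.chart (K.proj.toFun _) = _ at h3
    rw [h3] at habs
    exact Or.inr ⟨hd, s, by simpa using habs.2, rfl⟩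

/-- A regular knot diagram with a balanced weight has a local model at each of its points. -/
theorem nonempty_localModel [T2Space S] [IsManifold (𝓡 2) ∞ S] [OrientedAtlas S]
    {K : ThickenedKnot S} (hK : K.IsRegular) {n : UnitAddCircle → ℤ} (hn : IsBalanced K n)
    (θ : UnitAddCircle) : Nonempty (LocalModel K n (K.proj.toFun θ)) := by
  set q := K.proj.toFun θ with hq
  have hchart : ∀ θ', K.proj.toFun θ' = q →
      ContDiffAt ℝ 1 (fun r => chartAt Plane q (K.proj.branch θ' r)) 0 ∧
      HasDerivAt (fun r => chartAt Plane q (K.proj.branch θ' r)) (velocity K.proj.toFun θ') 0 ∧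
      ∀ᶠ r in 𝓝 0, K.proj.branch θ' r =
        (chartAt Plane q).symm (chartAt Plane q (K.proj.branch θ' r)) := by
    intro θ' hθ'
    have h0 : K.proj.branch θ' 0 = q := by rw [K.proj.branch_zero, hθ']
    refine ⟨?_, hasDerivAt_chart_curve h0 (K.proj.mdifferentiableAt_branch θ' 0), ?_⟩
    · have h1 : ContMDiffAt (𝓡 2) (𝓡 2) ∞ (chartAt Plane q) (K.proj.branch θ' 0) := by
        rw [h0]
        exact contMDiffAt_of_mem_maximalAtlas (IsManifold.chart_mem_maximalAtlas q)
          (mem_chart_source Plane q)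
      have h2 := ContMDiffAt.comp (g := chartAt Plane q) (f := K.proj.branch θ') (0 : ℝ) h1
        (K.proj.contMDiff_branch θ').contMDiffAt
      have h3 : ContDiffAt ℝ ∞ (chartAt Plane q ∘ K.proj.branch θ') 0 := contMDiffAt_iff_contDiffAt.1 h2
      exact h3.of_le (show (1 : WithTop ℕ∞) ≤ ∞ by simp)
    · have h1 : ∀ᶠ r in 𝓝 0, K.proj.branch θ' r ∈ (chartAt Plane q).source := by
        refine (K.proj.contMDiff_branch θ').continuous.continuousAt.eventually
          ((chartAt Plane q).open_source.mem_nhds ?_)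
        rw [h0]
        exact mem_chart_source Plane q
      filter_upwards [h1] with r hr
      exact ((chartAt Plane q).left_inv hr).symm
  obtain ⟨hc, hd, he⟩ := hchart θ rfl
  by_cases hdouble : ∃ θ', θ ≠ θ' ∧ K.proj.toFun θ' = q
  · obtain ⟨θ', hne, hθ'⟩ := hdouble
    obtain ⟨hc', hd', he'⟩ := hchart θ' hθ'
    obtain ⟨M⟩ := exists_adaptedChart q hc hc' (by simp [K.proj.branch_zero, hq])
      (by simp [K.proj.branch_zero, hθ']) hd hd' (hK.transverse θ θ' hne hθ'.symm)
    obtain ⟨δ, hδ⟩ := hn.double θ θ' hne hθ'.symm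
    refine nonempty_localModel_of_chart (θ₁ := θ) (θ₂ := θ') (double := True) (n₂ := n θ') (δ := δ)
      M he he' rfl (by simp) (fun _ φ hφ => ?_) (fun _ => hne) (fun _ => hθ') (fun _ => rfl)
      (hδ.mono fun r h => h.1) (fun _ => hδ.mono fun r h => h.2) (by simp)
    rcases hK.no_triple φ θ θ' hφ hθ'.symm with h | h | h
    · exact Or.inl h
    · exact absurd h hne
    · exact Or.inr h
  · have hfib : ∀ θ', K.proj.toFun θ' = q → θ' = θ := fun θ' h => by
      by_contra hne
      exact hdouble ⟨θ', fun h => hne h.symm, h⟩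
    set v := velocity K.proj.toFun θ with hv
    -- At a simple point, the line orthogonal to the velocity serves as the second axis.
    set w : Plane := !₂[-v 1, v 0] with hw
    have hvw : area v w ≠ 0 := by
      have h1 : area v w = v 0 * v 0 + v 1 * v 1 := by simp [area, hw]
      rw [h1]
      intro h2
      refine hK.immersed θ ?_
      ext i
      fin_cases i
      · change v 0 = 0
        nlinarith [mul_self_nonneg (v 0), mul_self_nonneg (v 1)]
      · change v 1 = 0
        nlinarith [mul_self_nonneg (v 0), mul_self_nonneg (v 1)]
    have hwd : HasDerivAt (fun r : ℝ => chartAt Plane q q + r • w) w 0 := by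
      simpa using ((hasDerivAt_id (0 : ℝ)).smul_const w).const_add (chartAt Plane q q)
    obtain ⟨M⟩ := exists_adaptedChart q (b₁ := fun r : ℝ => chartAt Plane q q + r • w) hc
      (contDiff_const.add (contDiff_id.smul contDiff_const)).contDiffAt
      (by simp [K.proj.branch_zero, hq]) (by simp) hd hwd hvw
    exact nonempty_localModel_of_chart (θ₁ := θ) (θ₂ := θ) (double := False) (n₂ := 0) (δ := 0)
      M he (Eventually.of_forall fun _ => rfl) rfl (fun _ => hfib) (by simp) (by simp) (by simp)
      (by simp) (by simpa using hn.simple θ hfib) (by simp) (by simp)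

end Local

/-! ### The local step functions of a weighted diagram -/

section Step

open Filter

theorem sgn_neg (x : ℝ) : sgn (-x) = -sgn x := by
  rcases lt_trichotomy x 0 with h | rfl | h
  · rw [sgn_of_neg h, sgn_of_pos (neg_pos.2 h)]
    rfl
  · simp [sgn_zero]
  · rw [sgn_of_pos h, sgn_of_neg (neg_neg_of_pos h)]

theorem sgn_eventually_eq {A : Type*} [TopologicalSpace A] {f : A → ℝ} {x : A}
    (hf : ContinuousAt f x) (hx : f x ≠ 0) : ∀ᶠ z in 𝓝 x, sgn (f z) = sgn (f x) := by
  rcases lt_or_gt_of_ne hx with h | h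
  · filter_upwards [hf.eventually (gt_mem_nhds h)] with z hz
    rw [sgn_of_neg h, sgn_of_neg hz]
  · filter_upwards [hf.eventually (lt_mem_nhds h)] with z hz
    rw [sgn_of_pos h, sgn_of_pos hz]

theorem sgn_eq_of_abs_sub_le {u c t : ℝ} (hc : c ≠ 0) (h : |u - t * c| ≤ |c| / 2 * |t|) :
    sgn u = sgn c * sgn t := by
  obtain ⟨h1, h2⟩ := abs_le.1 h
  rcases lt_trichotomy t 0 with ht | rfl | ht
  · rw [abs_of_neg ht] at h1 h2
    rcases lt_or_gt_of_ne hc with hc | hc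
    · rw [abs_of_neg hc] at h1 h2
      rw [sgn_of_neg ht, sgn_of_neg hc, sgn_of_pos]
      · rfl
      · nlinarith [mul_pos_of_neg_of_neg hc ht]
    · rw [abs_of_pos hc] at h1 h2
      rw [sgn_of_neg ht, sgn_of_pos hc, sgn_of_neg]
      · rfl
      · nlinarith [mul_neg_of_pos_of_neg hc ht]
  · have : u = 0 := by simpa using h
    rw [this, sgn_zero, mul_zero]
  · rw [abs_of_pos ht] at h1 h2
    rcases lt_or_gt_of_ne hc with hc | hc
    · rw [abs_of_neg hc] at h1 h2
      rw [sgn_of_pos ht, sgn_of_neg hc, sgn_of_neg]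
      · rfl
      · nlinarith [mul_neg_of_neg_of_pos hc ht]
    · rw [abs_of_pos hc] at h1 h2
      rw [sgn_of_pos ht, sgn_of_pos hc, sgn_of_pos]
      · rfl
      · nlinarith [mul_pos hc ht]

/-- A function with derivative `c ≠ 0` at its zero `0` has the sign of its linear part there. -/
theorem sgn_eventually_of_hasDerivAt {f : ℝ → ℝ} {c : ℝ} (hf : HasDerivAt f c 0) (h0 : f 0 = 0)
    (hc : c ≠ 0) : ∀ᶠ r in 𝓝 0, sgn (f r) = sgn c * sgn r := by
  have h := (hasDerivAt_iff_isLittleO.1 hf).def (half_pos (abs_pos.2 hc))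
  filter_upwards [h] with r hr
  refine sgn_eq_of_abs_sub_le hc ?_
  simpa [h0, Real.norm_eq_abs] using hr

/-- A coordinate function that vanishes on the first axis and has derivative `c ≠ 0` along the
second axis at the origin has the sign of `c` times the second coordinate near the origin. -/
theorem sgn_eventually_of_hasStrictFDerivAt {F : Plane → Plane} {L : Plane →L[ℝ] Plane}
    (hF : HasStrictFDerivAt F L 0) (i : Fin 2) (h0 : ∀ᶠ s : ℝ in 𝓝 0, F !₂[s, 0] i = 0)
    (hc : L !₂[0, 1] i ≠ 0) : ∀ᶠ z in 𝓝 0, sgn (F z i) = sgn (L !₂[0, 1] i) * sgn (z 1) := by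
  have hp : ∀ i : Fin 2, Continuous fun z : Plane => z i := fun i =>
    (EuclideanSpace.proj i : Plane →L[ℝ] ℝ).continuous
  have hc0 : Tendsto (fun z : Plane => z 0) (𝓝 0) (𝓝 0) := by simpa using (hp 0).tendsto 0
  have hfoot : Continuous fun z : Plane => (!₂[z 0, 0] : Plane) := by fun_prop
  have hf0 : (!₂[0, 0] : Plane) = 0 := by
    ext j
    fin_cases j <;> rfl
  have htend : Tendsto (fun z : Plane => (z, (!₂[z 0, 0] : Plane))) (𝓝 0) (𝓝 (0, 0)) := by
    have := (continuous_id.prodMk hfoot).tendsto (0 : Plane)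
    simpa [hf0] using this
  have h := htend.eventually (hF.isLittleO.def (half_pos (abs_pos.2 hc)))
  filter_upwards [h, hc0.eventually h0] with z hz hz0
  refine sgn_eq_of_abs_sub_le hc ?_
  have hsub : z - !₂[z 0, 0] = z 1 • (!₂[0, 1] : Plane) := by
    ext j
    fin_cases j <;> simp
  simp only [hsub] at hz
  have hnorm : ‖z 1 • (!₂[0, 1] : Plane)‖ = |z 1| := by
    rw [norm_smul, EuclideanSpace.norm_eq]
    simp
  rw [hnorm] at hz
  refine le_trans ?_ hz
  have h2 := PiLp.norm_apply_le (F z - F !₂[z 0, 0] - L (z 1 • (!₂[0, 1] : Plane))) i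
  simpa [hz0, Real.norm_eq_abs] using h2

variable {S : Type u} [TopologicalSpace S] [ChartedSpace Plane S]

theorem AdaptedChart.orient_mul_self {a b : ℝ → S} (M : AdaptedChart a b) :
    M.orient * M.orient = 1 := by
  rcases M.orient_eq with h | h <;> rw [h] <;> rfl

theorem AdaptedChart.sgn_eq_orient {a b : ℝ → S} (M : AdaptedChart a b) {x : ℝ}
    (h : 0 < (M.orient : ℝ) * x) : sgn x = M.orient := by
  rcases M.orient_eq with e | e <;> rw [e] at h ⊢
  · exact sgn_of_pos (by simpa using h)
  · exact sgn_of_neg (by simpa using h)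

theorem AdaptedChart.sgn_mul {a b : ℝ → S} (M : AdaptedChart a b) {x y : ℝ}
    (h : 0 < (M.orient : ℝ) * x) : sgn (x * y) = M.orient * sgn y := by
  rcases M.orient_eq with e | e <;> rw [e] at h ⊢ <;> rcases lt_trichotomy y 0 with hy | rfl | hy
  · rw [sgn_of_neg hy, sgn_of_neg (mul_neg_of_pos_of_neg (by simpa using h) hy), one_mul]
  · simp [sgn_zero]
  · rw [sgn_of_pos hy, sgn_of_pos (mul_pos (by simpa using h) hy), one_mul]
  · rw [sgn_of_neg hy, sgn_of_pos (mul_pos_of_neg_of_neg (by simpa using h) hy)]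
    rfl
  · simp [sgn_zero]
  · rw [sgn_of_pos hy, sgn_of_neg (mul_neg_of_neg_of_pos (by simpa using h) hy), mul_one]

theorem AdaptedChart.symm_fst_axis {a b : ℝ → S} (M : AdaptedChart a b) {s : ℝ}
    (hs : |s| < M.radius) : M.chart.symm !₂[s, 0] = a s := by
  obtain ⟨h1, h2⟩ := M.fst_axis s hs
  rw [← h2, M.chart.left_inv h1]

theorem AdaptedChart.eventually_abs_lt {a b : ℝ → S} (M : AdaptedChart a b) :
    ∀ᶠ s : ℝ in 𝓝 0, |s| < M.radius := by
  have : Tendsto (fun s : ℝ => |s|) (𝓝 0) (𝓝 0) := by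
    simpa using continuous_abs.tendsto (0 : ℝ)
  exact this.eventually (gt_mem_nhds M.radius_pos)

/-- Changes of adapted coordinates are strictly differentiable, and their determinants have the
sign prescribed by the orientations. -/
theorem AdaptedChart.exists_hasStrictFDerivAt {a b a' b' : ℝ → S} (M : AdaptedChart a b)
    (N : AdaptedChart a' b') (h : a' 0 ∈ M.chart.source) :
    ∃ L : Plane →L[ℝ] Plane, HasStrictFDerivAt (M.chart ∘ N.chart.symm) L 0 ∧
      0 < ((M.orient * N.orient : ℤ) : ℝ) * L.det := by
  have hs := N.mem_source
  have h0 := N.chart_zero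
  have c1 := M.contMDiffAt _ h
  have c2 := N.contMDiffAt_symm _ hs
  have hinv : N.chart.symm 0 = a' 0 := by rw [← h0, N.chart.left_inv hs]
  have hcomp : ContMDiffAt (𝓡 2) (𝓡 2) 1 (M.chart ∘ N.chart.symm) 0 := by
    rw [h0] at c2
    refine ContMDiffAt.comp (0 : Plane) ?_ c2
    rw [hinv]
    exact c1
  have hcd : ContDiffAt ℝ 1 (M.chart ∘ N.chart.symm) 0 := contMDiffAt_iff_contDiffAt.1 hcomp
  refine ⟨_, hcd.hasStrictFDerivAt one_ne_zero, ?_⟩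
  have e1 := planeDeriv_comp_symm hs ((N.contMDiffAt _ hs).mdifferentiableAt (by simp))
    (c2.mdifferentiableAt (by simp))
  have e2 : fderiv ℝ (M.chart ∘ N.chart.symm) 0 =
      (planeDeriv M.chart (a' 0)).comp (planeDeriv N.chart.symm (N.chart (a' 0))) := by
    rw [← planeDeriv_eq_fderiv, h0]
    rw [h0] at c2
    exact planeDeriv_comp hinv (c2.mdifferentiableAt (by simp)) (c1.mdifferentiableAt (by simp))
  have e3 := congrArg ContinuousLinearMap.det e1
  have e4 : (ContinuousLinearMap.id ℝ Plane).det = 1 := LinearMap.det_id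
  rw [det_comp_plane, e4] at e3
  rw [e2, det_comp_plane]
  have p1 := M.det_pos _ h
  have p2 := N.det_pos _ hs
  set dM := (planeDeriv M.chart (a' 0)).det
  set dN := (planeDeriv N.chart (a' 0)).det
  set dS := (planeDeriv N.chart.symm (N.chart (a' 0))).det
  have p3 : 0 < (N.orient : ℝ) * dS := by
    have hsq : ((N.orient : ℝ) * dS) * ((N.orient : ℝ) * dN) = 1 := by
      have : ((N.orient * N.orient : ℤ) : ℝ) = 1 := by rw [N.orient_mul_self]; simp
      push_cast at this
      linear_combination dS * dN * this + e3
    exact pos_of_mul_pos_left (by rw [hsq]; exact one_pos) p2.le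
  have := mul_pos p1 p3
  push_cast
  linarith

namespace LocalModel

variable {K : ThickenedKnot S} {n : UnitAddCircle → ℤ} {p q : S}

/-- The local step function of a weighted diagram. Its jump when a branch of weight `w` is crossed
from right to left is `2 * w`, and its value on the diagram is the mean value of the values on both
sides. -/
noncomputable def step (M : LocalModel K n q) (z : S) : ℤ :=
  M.coords.orient * (M.n₁ * sgn (M.coords.chart z 1) - M.n₂ * sgn (M.coords.chart z 0) +
    M.δ * sgn (M.coords.chart z 0) * sgn (M.coords.chart z 1))

theorem branch_zero (M : LocalModel K n q) : K.proj.branch M.θ₁ 0 = q := by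
  rw [K.proj.branch_zero, M.proj_θ₁]

theorem mem_source (M : LocalModel K n q) : q ∈ M.coords.chart.source := by
  have := M.coords.mem_source
  rwa [M.branch_zero] at this

theorem chart_self (M : LocalModel K n q) : M.coords.chart q = 0 := by
  have := M.coords.chart_zero
  rwa [M.branch_zero] at this

theorem n₁_eq (M : LocalModel K n q) : M.n₁ = n M.θ₁ := by
  have := M.weight₁ 0 (by simpa using M.coords.radius_pos)
  simpa [sgn_zero] using this.symm

theorem n₂_eq (M : LocalModel K n q) (hd : M.double) : M.n₂ = n M.θ₂ := by
  have := M.weight₂ hd 0 (by simpa using M.coords.radius_pos)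
  simpa [sgn_zero] using this.symm

theorem step_self (M : LocalModel K n q) : M.step q = 0 := by
  simp [step, chart_self, sgn_zero]

theorem chart_fst (M : LocalModel K n q) {s : ℝ} (hs : |s| < M.coords.radius) :
    M.coords.chart (K.proj.toFun (M.θ₁ + (s : UnitAddCircle))) = !₂[s, 0] :=
  (M.coords.fst_axis s hs).2

theorem chart_snd (M : LocalModel K n q) (hd : M.double) {s : ℝ} (hs : |s| < M.coords.radius) :
    M.coords.chart (K.proj.toFun (M.θ₂ + (s : UnitAddCircle))) = !₂[0, s] := by
  have h := (M.coords.snd_axis s hs).2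
  rwa [congrFun (M.transversal_eq hd) s] at h

theorem continuousAt_coord (M : LocalModel K n p) (hq : q ∈ M.coords.chart.source) (i : Fin 2) :
    ContinuousAt (fun z => M.coords.chart z i) q :=
  (EuclideanSpace.proj i : Plane →L[ℝ] ℝ).continuous.continuousAt.comp
    (M.coords.chart.continuousAt hq)

theorem eq_of_coord (M : LocalModel K n p) (hq : q ∈ M.coords.chart.source)
    {x : S} (hx : x ∈ M.coords.chart.source) (h : M.coords.chart q = M.coords.chart x) : q = x :=
  M.coords.chart.injOn hq hx h

/-- Away from the diagram, the local step functions are locally constant. -/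
theorem step_eventually_eq (M : LocalModel K n p) (hq : q ∈ M.coords.chart.source)
    (hqD : q ∉ Set.range K.proj.toFun) : ∀ᶠ z in 𝓝 q, M.step z = M.step q := by
  have habs := M.coords.abs_lt q hq
  have h1 : M.coords.chart q 1 ≠ 0 := by
    intro h
    have hx := M.coords.fst_axis _ habs.1
    refine hqD ⟨M.θ₁ + (M.coords.chart q 0 : ℝ), (M.eq_of_coord hq hx.1 ?_).symm⟩
    rw [hx.2]
    ext i
    fin_cases i
    · rfl
    · exact h
  by_cases hd : M.double
  · have h0 : M.coords.chart q 0 ≠ 0 := by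
      intro h
      have hx := M.coords.snd_axis _ habs.2
      refine hqD ⟨M.θ₂ + (M.coords.chart q 1 : ℝ), ?_⟩
      refine Eq.trans ?_ (M.eq_of_coord hq hx.1 ?_).symm
      · exact (congrFun (M.transversal_eq hd) _).symm
      · rw [hx.2]
        ext i
        fin_cases i
        · exact h
        · rfl
    filter_upwards [sgn_eventually_eq (M.continuousAt_coord hq 0) h0,
      sgn_eventually_eq (M.continuousAt_coord hq 1) h1] with z hz0 hz1
    rw [step, step, hz0, hz1]
  · obtain ⟨e1, e2⟩ := M.weight_simple hd
    filter_upwards [sgn_eventually_eq (M.continuousAt_coord hq 1) h1] with z hz1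
    rw [step, step, hz1, e1, e2]
    ring

/-- On the overlap of two local models, the local step functions agree up to a constant near each
point of the diagram. -/
theorem step_sub_step_eventually_eq (M : LocalModel K n p) (N : LocalModel K n q)
    (hq : q ∈ M.coords.chart.source) (hpq : q ≠ p) :
    ∀ᶠ z in 𝓝 q, M.step z - N.step z = M.step q - N.step q := by
  have hpre : ∀ θ, K.proj.toFun θ = q →
      (∃ s : ℝ, s ≠ 0 ∧ |s| < M.coords.radius ∧ θ = M.θ₁ + (s : UnitAddCircle) ∧
        M.coords.chart q = !₂[s, 0]) ∨
      M.double ∧ ∃ s : ℝ, s ≠ 0 ∧ |s| < M.coords.radius ∧ θ = M.θ₂ + (s : UnitAddCircle) ∧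
        M.coords.chart q = !₂[0, s] := by
    intro θ hθ
    rcases M.preimage θ (by rwa [hθ]) with ⟨s, hs, rfl⟩ | ⟨hd, s, hs, rfl⟩
    · refine Or.inl ⟨s, ?_, hs, rfl, ?_⟩
      · rintro rfl
        exact hpq (hθ.symm.trans (by simpa using M.proj_θ₁))
      · rw [← hθ]
        exact M.chart_fst hs
    · refine Or.inr ⟨hd, s, ?_, hs, rfl, ?_⟩
      · rintro rfl
        exact hpq (hθ.symm.trans (by simpa using M.proj_θ₂ hd))
      · rw [← hθ]
        exact M.chart_snd hd hs
  -- A crossing in the domain of `M` is the origin of `M`, so `q` is a simple point of the diagram.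
  have hNd : ¬N.double := by
    intro hd
    rcases hpre _ N.proj_θ₁ with ⟨s, hs0, hs, h1, h2⟩ | ⟨-, s, hs0, hs, h1, h2⟩ <;>
    rcases hpre _ (N.proj_θ₂ hd) with ⟨t, ht0, ht, h3, h4⟩ | ⟨-, t, ht0, ht, h3, h4⟩ <;>
    rw [h2] at h4
    · have : s = t := by simpa using congrArg (fun z : Plane => z 0) h4
      exact N.ne hd (by rw [h1, h3, this])
    · exact hs0 (by simpa using congrArg (fun z : Plane => z 0) h4)
    · exact hs0 (by simpa using congrArg (fun z : Plane => z 1) h4)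
    · have : s = t := by simpa using congrArg (fun z : Plane => z 1) h4
      exact N.ne hd (by rw [h1, h3, this])
  obtain ⟨hN2, hNδ⟩ := N.weight_simple hNd
  obtain ⟨L, hL, hdet⟩ := M.coords.exists_hasStrictFDerivAt N.coords
    (by rw [N.branch_zero]; exact hq)
  have hNc : Tendsto N.coords.chart (𝓝 q) (𝓝 0) := by
    have := N.coords.chart.continuousAt N.mem_source
    rwa [ContinuousAt, N.chart_self] at this
  have hleft : ∀ᶠ z in 𝓝 q, N.coords.chart.symm (N.coords.chart z) = z :=
    N.coords.chart.eventually_left_inverse N.mem_source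
  have hline : HasDerivAt (fun s : ℝ => (!₂[s, 0] : Plane)) !₂[1, 0] 0 := by
    have h := (hasDerivAt_id (0 : ℝ)).smul_const (!₂[1, 0] : Plane)
    have e : (fun s : ℝ => (!₂[s, 0] : Plane)) = fun s : ℝ => id s • (!₂[1, 0] : Plane) := by
      funext s
      ext i
      fin_cases i <;> simp
    rw [e]
    simpa using h
  have hline0 : (!₂[(0 : ℝ), 0] : Plane) = 0 := by
    ext j
    fin_cases j <;> rfl
  have hLe : HasDerivAt (fun s : ℝ => (M.coords.chart ∘ N.coords.chart.symm) !₂[s, 0])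
      (L !₂[1, 0]) 0 := by
    have h : HasFDerivAt (M.coords.chart ∘ N.coords.chart.symm) L !₂[(0 : ℝ), 0] := by
      rw [hline0]
      exact hL.hasFDerivAt
    exact h.comp_hasDerivAt (0 : ℝ) hline
  have harea := area_map L !₂[1, 0] !₂[0, 1]
  have hMM := M.coords.orient_mul_self
  have hunit : M.coords.orient * N.coords.orient = 1 ∨ M.coords.orient * N.coords.orient = -1 := by
    rcases M.coords.orient_eq with e | e <;> rcases N.coords.orient_eq with e' | e' <;>
      rw [e, e'] <;> simp
  have hsgndet : sgn L.det = M.coords.orient * N.coords.orient := by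
    rcases hunit with e | e <;> rw [e] at hdet ⊢
    · exact sgn_of_pos (by simpa using hdet)
    · exact sgn_of_neg (by simpa using hdet)
  have hdet0 : L.det ≠ 0 := fun h => by simp [h] at hdet
  -- The branch through `q` is the first axis of `N` and an axis of `M`. Hence one column of the
  -- derivative `L` of the coordinate change is a standard basis vector, and `det L`, whose sign compares
  -- the orientations, is up to sign the derivative of the coordinate of `M` transverse to this axis.
  rcases hpre _ N.proj_θ₁ with ⟨x, hx0, hx, h1, h2⟩ | ⟨hd, y, hy0, hy, h1, h2⟩
  · have hF : ∀ᶠ s : ℝ in 𝓝 0,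
        (M.coords.chart ∘ N.coords.chart.symm) !₂[s, 0] = !₂[x + s, 0] := by
      have ht : Tendsto (fun s : ℝ => |x + s|) (𝓝 0) (𝓝 |x|) := by
        simpa using ((continuous_const_add x).abs.tendsto 0)
      filter_upwards [N.coords.eventually_abs_lt, ht.eventually (gt_mem_nhds hx)] with s hs hs'
      rw [Function.comp_apply, N.coords.symm_fst_axis hs, ClosedCurve.branch, h1, add_assoc,
        ← QuotientAddGroup.mk_add]
      exact M.chart_fst hs'
    have hLe' : L !₂[1, 0] = !₂[1, 0] := by
      refine hLe.unique (HasDerivAt.congr_of_eventuallyEq ?_ hF)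
      have e : (fun s : ℝ => (!₂[x + s, 0] : Plane)) =
          fun s : ℝ => (!₂[x, 0] : Plane) + !₂[s, 0] := by
        funext s
        ext i
        fin_cases i <;> simp
      rw [e]
      exact hline.const_add _
    have hc : L !₂[0, 1] 1 = L.det := by
      rw [hLe'] at harea
      simpa [area] using harea
    have hkey := sgn_eventually_of_hasStrictFDerivAt hL 1 (hF.mono fun s hs => by rw [hs]; rfl)
      (by rw [hc]; exact hdet0)
    have hn := M.weight₁ x hx
    rw [← h1, ← N.n₁_eq] at hn
    have hx' : M.coords.chart q 0 = x := by rw [h2]; rfl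
    have hy' : M.coords.chart q 1 = 0 := by rw [h2]; rfl
    filter_upwards [hNc.eventually hkey, hleft,
      sgn_eventually_eq (M.continuousAt_coord hq 0) (by rw [hx']; exact hx0)] with z hz hz' hz0
    rw [Function.comp_apply, hz', hc, hsgndet] at hz
    rw [hx'] at hz0
    rw [N.step_self, step, step, step, hz, hz0, hx', hy', sgn_zero, hN2, hNδ, hn]
    linear_combination (N.coords.orient * (M.n₁ + M.δ * sgn x) * sgn (N.coords.chart z 1)) * hMM
  · have hF : ∀ᶠ s : ℝ in 𝓝 0,
        (M.coords.chart ∘ N.coords.chart.symm) !₂[s, 0] = !₂[0, y + s] := by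
      have ht : Tendsto (fun s : ℝ => |y + s|) (𝓝 0) (𝓝 |y|) := by
        simpa using ((continuous_const_add y).abs.tendsto 0)
      filter_upwards [N.coords.eventually_abs_lt, ht.eventually (gt_mem_nhds hy)] with s hs hs'
      rw [Function.comp_apply, N.coords.symm_fst_axis hs, ClosedCurve.branch, h1, add_assoc,
        ← QuotientAddGroup.mk_add]
      exact M.chart_snd hd hs'
    have hLe' : L !₂[1, 0] = !₂[0, 1] := by
      refine hLe.unique (HasDerivAt.congr_of_eventuallyEq ?_ hF)
      have e : (fun s : ℝ => (!₂[0, y + s] : Plane)) =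
          fun s : ℝ => (!₂[0, y] : Plane) + id s • !₂[0, 1] := by
        funext s
        ext i
        fin_cases i <;> simp
      rw [e]
      simpa using ((hasDerivAt_id (0 : ℝ)).smul_const (!₂[0, 1] : Plane)).const_add !₂[0, y]
    have hc : L !₂[0, 1] 0 = -L.det := by
      rw [hLe'] at harea
      have : -L !₂[0, 1] 0 = L.det := by simpa [area] using harea
      linarith
    have hkey := sgn_eventually_of_hasStrictFDerivAt hL 0 (hF.mono fun s hs => by rw [hs]; rfl)
      (by rw [hc]; exact neg_ne_zero.2 hdet0)
    have hn := M.weight₂ hd y hy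
    rw [← h1, ← N.n₁_eq] at hn
    have hx' : M.coords.chart q 0 = 0 := by rw [h2]; rfl
    have hy' : M.coords.chart q 1 = y := by rw [h2]; rfl
    filter_upwards [hNc.eventually hkey, hleft,
      sgn_eventually_eq (M.continuousAt_coord hq 1) (by rw [hy']; exact hy0)] with z hz hz' hz1
    rw [Function.comp_apply, hz', hc, sgn_neg, hsgndet] at hz
    rw [hy'] at hz1
    rw [N.step_self, step, step, step, hz, hz1, hx', hy', sgn_zero, hN2, hNδ, hn]
    linear_combination (N.coords.orient * (M.n₂ - M.δ * sgn y) * sgn (N.coords.chart z 1)) * hMM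

theorem hasJump_sgn : HasJump (fun r => (sgn r : ℝ)) 0 2 := by
  refine ⟨-1, ?_, ?_⟩
  · filter_upwards [self_mem_nhdsWithin] with r hr
    rw [sgn_of_neg hr]
    simp
  · filter_upwards [self_mem_nhdsWithin] with r hr
    rw [sgn_of_pos hr]
    norm_num

theorem hasJump_of_eventually_eq {f : ℝ → ℤ} {c : ℤ} (h : ∀ᶠ r in 𝓝 0, f r = c * sgn r) :
    HasJump (fun r => (f r : ℝ)) 0 ((2 * c : ℤ) : ℝ) := by
  have h1 := (hasJump_sgn.const_mul (c : ℝ)).congr (G := fun r => (f r : ℝ))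
    ((h.filter_mono nhdsWithin_le_nhds).mono fun r hr => by rw [hr]; push_cast; ring)
  convert h1 using 1
  push_cast
  ring

theorem hasJump_step_fst (M : LocalModel K n q) :
    HasJump (fun r : ℝ => (M.step (K.proj.toFun (M.θ₁ + (r : UnitAddCircle))) : ℝ)) 0
      ((2 * (-(M.coords.orient * M.n₂)) : ℤ) : ℝ) := by
  refine hasJump_of_eventually_eq ?_
  filter_upwards [M.coords.eventually_abs_lt] with r hr
  have h0 : M.coords.chart (K.proj.toFun (M.θ₁ + (r : UnitAddCircle))) 0 = r := by
    rw [M.chart_fst hr]; rfl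
  have h1 : M.coords.chart (K.proj.toFun (M.θ₁ + (r : UnitAddCircle))) 1 = 0 := by
    rw [M.chart_fst hr]; rfl
  rw [step, h0, h1, sgn_zero]
  ring

theorem hasJump_step_snd (M : LocalModel K n q) (hd : M.double) :
    HasJump (fun r : ℝ => (M.step (K.proj.toFun (M.θ₂ + (r : UnitAddCircle))) : ℝ)) 0
      ((2 * (M.coords.orient * M.n₁) : ℤ) : ℝ) := by
  refine hasJump_of_eventually_eq ?_
  filter_upwards [M.coords.eventually_abs_lt] with r hr
  have h0 : M.coords.chart (K.proj.toFun (M.θ₂ + (r : UnitAddCircle))) 0 = 0 := by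
    rw [M.chart_snd hd hr]; rfl
  have h1 : M.coords.chart (K.proj.toFun (M.θ₂ + (r : UnitAddCircle))) 1 = r := by
    rw [M.chart_snd hd hr]; rfl
  rw [step, h0, h1, sgn_zero]
  ring

/-- The coordinate expression of the velocity of a curve through `q`. -/
theorem hasDerivAt_coords (M : LocalModel K n q) {γ : ClosedCurve S} {s : UnitAddCircle}
    (hs : γ.toFun s = q) :
    HasDerivAt (fun r => M.coords.chart (γ.branch s r))
      (planeDeriv M.coords.chart q (velocity γ.toFun s)) 0 := by
  rw [velocity_eq_curveVelocity]
  exact hasDerivAt_comp_curve (by rw [γ.branch_zero, hs])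
    ((M.coords.contMDiffAt q M.mem_source).mdifferentiableAt (by simp))
    (γ.mdifferentiableAt_branch s 0)

theorem planeDeriv_velocity_fst (M : LocalModel K n q) :
    planeDeriv M.coords.chart q (velocity K.proj.toFun M.θ₁) = !₂[1, 0] := by
  refine (M.hasDerivAt_coords M.proj_θ₁).unique
    (HasDerivAt.congr_of_eventuallyEq (f := fun r : ℝ => r • (!₂[1, 0] : Plane)) ?_ ?_)
  · simpa using (hasDerivAt_id (0 : ℝ)).smul_const (!₂[1, 0] : Plane)
  · filter_upwards [M.coords.eventually_abs_lt] with r hr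
    refine (M.chart_fst hr).trans ?_
    ext i
    fin_cases i <;> simp

theorem planeDeriv_velocity_snd (M : LocalModel K n q) (hd : M.double) :
    planeDeriv M.coords.chart q (velocity K.proj.toFun M.θ₂) = !₂[0, 1] := by
  refine (M.hasDerivAt_coords (M.proj_θ₂ hd)).unique
    (HasDerivAt.congr_of_eventuallyEq (f := fun r : ℝ => r • (!₂[0, 1] : Plane)) ?_ ?_)
  · simpa using (hasDerivAt_id (0 : ℝ)).smul_const (!₂[0, 1] : Plane)
  · filter_upwards [M.coords.eventually_abs_lt] with r hr
    refine (M.chart_snd hd hr).trans ?_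
    ext i
    fin_cases i <;> simp

theorem orient_eq_sgn (M : LocalModel K n q) (hd : M.double) :
    sgn (tangentArea K.proj.toFun K.proj.toFun M.θ₁ M.θ₂) = M.coords.orient := by
  have h := area_map (planeDeriv M.coords.chart q) (velocity K.proj.toFun M.θ₁)
    (velocity K.proj.toFun M.θ₂)
  rw [M.planeDeriv_velocity_fst, M.planeDeriv_velocity_snd hd] at h
  have h1 : (planeDeriv M.coords.chart q).det *
      tangentArea K.proj.toFun K.proj.toFun M.θ₁ M.θ₂ = 1 := by
    rw [tangentArea, ← h]
    simp [area]
  have h2 := M.coords.det_pos q M.mem_source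
  refine M.coords.sgn_eq_orient (pos_of_mul_pos_left (b := (M.coords.orient : ℝ) *
    (planeDeriv M.coords.chart q).det) ?_ h2.le)
  have h3 : ((M.coords.orient * M.coords.orient : ℤ) : ℝ) = 1 := by
    rw [M.coords.orient_mul_self]; simp
  push_cast at h3
  have h4 : (M.coords.orient : ℝ) * tangentArea K.proj.toFun K.proj.toFun M.θ₁ M.θ₂ *
      ((M.coords.orient : ℝ) * (planeDeriv M.coords.chart q).det) = 1 := by
    linear_combination h3 + (M.coords.orient : ℝ) * M.coords.orient * h1
  rw [h4]
  exact one_pos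

/-- The jump of the local step function along a curve that crosses the diagram transversally at a
simple point. -/
theorem hasJump_step_curve (M : LocalModel K n q) (hd : ¬M.double) {γ : ClosedCurve S}
    {s : UnitAddCircle} (hs : γ.toFun s = q)
    (htr : tangentArea K.proj.toFun γ.toFun M.θ₁ s ≠ 0) :
    HasJump (fun r : ℝ => (M.step (γ.toFun (s + (r : UnitAddCircle))) : ℝ)) 0
      ((2 * (M.n₁ * sgn (tangentArea K.proj.toFun γ.toFun M.θ₁ s)) : ℤ) : ℝ) := by
  obtain ⟨e1, e2⟩ := M.weight_simple hd
  have h := area_map (planeDeriv M.coords.chart q) (velocity K.proj.toFun M.θ₁)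
    (velocity γ.toFun s)
  rw [M.planeDeriv_velocity_fst] at h
  have h1 : planeDeriv M.coords.chart q (velocity γ.toFun s) 1 =
      (planeDeriv M.coords.chart q).det * tangentArea K.proj.toFun γ.toFun M.θ₁ s := by
    rw [tangentArea, ← h]
    simp [area]
  have h2 := M.coords.det_pos q M.mem_source
  have h3 : planeDeriv M.coords.chart q (velocity γ.toFun s) 1 ≠ 0 := by
    rw [h1]
    exact mul_ne_zero (fun h0 => by simp [h0] at h2) htr
  have h4 : HasDerivAt (fun r => M.coords.chart (γ.branch s r) 1)
      (planeDeriv M.coords.chart q (velocity γ.toFun s) 1) 0 :=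
    (EuclideanSpace.proj (1 : Fin 2) : Plane →L[ℝ] ℝ).hasFDerivAt.comp_hasDerivAt (0 : ℝ)
      (M.hasDerivAt_coords hs)
  have h5 := sgn_eventually_of_hasDerivAt h4
    (by rw [γ.branch_zero, hs, M.chart_self]; rfl) h3
  refine hasJump_of_eventually_eq ?_
  filter_upwards [h5] with r hr
  rw [h1, M.coords.sgn_mul h2] at hr
  change M.step (γ.branch s r) = _
  rw [step, hr, e1, e2]
  linear_combination (M.n₁ * sgn (tangentArea K.proj.toFun γ.toFun M.θ₁ s) * sgn r) *
    M.coords.orient_mul_self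

end LocalModel

end Step

/-! ### Weighted intersection numbers -/

section Intersection

open Filter

variable {S : Type u} [TopologicalSpace S] [ChartedSpace Plane S]

theorem tangentArea_swap (f g : UnitAddCircle → S) (θ θ' : UnitAddCircle) :
    tangentArea f g θ θ' = -tangentArea g f θ' θ := by
  rw [tangentArea, tangentArea, area, area]
  ring

theorem sgn_eq_zero {x : ℝ} : sgn x = 0 ↔ x = 0 := by
  refine ⟨fun h => ?_, fun h => by rw [h, sgn_zero]⟩
  rcases lt_trichotomy x 0 with hx | hx | hx
  · simp [sgn_of_neg hx] at h
  · exact hx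
  · simp [sgn_of_pos hx] at h

theorem ThickenedKnot.exists_crossing {K : ThickenedKnot S} {θ θ' : UnitAddCircle} (hne : θ ≠ θ')
    (h : K.proj.toFun θ = K.proj.toFun θ') :
    ∃ c : K.Crossing, c.overParam = θ ∧ c.underParam = θ' ∨
      c.overParam = θ' ∧ c.underParam = θ := by
  rcases lt_trichotomy (K.height θ) (K.height θ') with hlt | heq | hlt
  · exact ⟨⟨θ', θ, h.symm, hlt⟩, Or.inr ⟨rfl, rfl⟩⟩
  · exact absurd (K.injective (Prod.ext h heq)) hne
  · exact ⟨⟨θ, θ', h, hlt⟩, Or.inl ⟨rfl, rfl⟩⟩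

theorem ThickenedKnot.IsGeneric.eq_of_proj_eq {K : ThickenedKnot S} {γ : ClosedCurve S}
    (hγ : K.IsGeneric γ) {s θ θ' : UnitAddCircle} (h : γ.toFun s = K.proj.toFun θ)
    (h' : γ.toFun s = K.proj.toFun θ') : θ = θ' := by
  by_contra hne
  obtain ⟨c, hc | hc⟩ := ThickenedKnot.exists_crossing hne (h.symm.trans h')
  · exact hγ.avoids c s (by rw [hc.1, h])
  · exact hγ.avoids c s (by rw [hc.1, h'])

/-- A balanced weight on a regular diagram determines a map from the surface to the circle. Its
degree on a closed curve is, up to the factor `-2`, the weighted intersection number of the diagram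
with the curve, both for curves in general position and for the diagram itself. -/
theorem exists_circle_map [T2Space S] [CompactSpace S] [IsManifold (𝓡 2) ∞ S] [OrientedAtlas S]
    {K : ThickenedKnot S} (hK : K.IsRegular) {n : UnitAddCircle → ℤ} (hn : IsBalanced K n) :
    ∃ g : C(S, UnitAddCircle),
      (∀ γ : ClosedCurve S, K.IsGeneric γ → ∀ k : UnitAddCircle → ℤ,
        (∀ s θ, γ.toFun s = K.proj.toFun θ →
          k s = 2 * (n θ * sgn (tangentArea K.proj.toFun γ.toFun θ s))) →
        (∀ s, γ.toFun s ∉ Set.range K.proj.toFun → k s = 0) →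
        ∃ P : Finset UnitAddCircle, (∀ s, s ∈ P ↔ k s ≠ 0) ∧
          angleCochain g (loopSimplex ⟨γ.toFun, γ.continuous_toFun⟩) = -∑ s ∈ P, (k s : ℝ)) ∧
      ∀ k : UnitAddCircle → ℤ,
        (∀ θ θ', θ ≠ θ' → K.proj.toFun θ = K.proj.toFun θ' →
          k θ = 2 * (n θ' * sgn (tangentArea K.proj.toFun K.proj.toFun θ' θ))) →
        (∀ θ, (∀ θ', K.proj.toFun θ = K.proj.toFun θ' → θ = θ') → k θ = 0) →
        ∃ P : Finset UnitAddCircle, (∀ s, s ∈ P ↔ k s ≠ 0) ∧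
          angleCochain g (loopSimplex ⟨K.proj.toFun, K.proj.continuous_toFun⟩) =
            -∑ s ∈ P, (k s : ℝ) := by
  classical
  have M : ∀ p ∈ Set.range K.proj.toFun, LocalModel K n p := fun p hp =>
    Classical.choice (by
      obtain ⟨θ, rfl⟩ := hp
      exact nonempty_localModel hK hn θ)
  have hclosed : IsClosed (Set.range K.proj.toFun) :=
    (isCompact_range K.proj.continuous_toFun).isClosed
  obtain ⟨U, hU⟩ : ∃ U : S → Set S, ∀ p, U p =
      if hp : p ∈ Set.range K.proj.toFun then (M p hp).coords.chart.source
      else (Set.range K.proj.toFun)ᶜ := ⟨_, fun p => rfl⟩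
  obtain ⟨h, hh⟩ : ∃ h : S → S → ℤ, ∀ p, h p =
      if hp : p ∈ Set.range K.proj.toFun then (M p hp).step else fun _ => 0 :=
    ⟨_, fun p => rfl⟩
  have hUo : ∀ p, IsOpen (U p) := fun p => by
    rw [hU]
    split_ifs with hp
    · exact (M p hp).coords.chart.open_source
    · exact hclosed.isOpen_compl
  have hUm : ∀ p, p ∈ U p := fun p => by
    rw [hU]
    split_ifs with hp
    · exact (M p hp).mem_source
    · exact hp
  have hcompat : ∀ p, ∀ q ∈ U p, ∀ᶠ z in 𝓝 q, h p z - h q z = h p q - h q q := fun p q hq => by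
    rw [hU] at hq
    by_cases hpq : q = p
    · subst hpq
      simp
    rw [hh p, hh q]
    by_cases hp : p ∈ Set.range K.proj.toFun
    · rw [dif_pos hp] at hq ⊢
      by_cases hqD : q ∈ Set.range K.proj.toFun
      · rw [dif_pos hqD]
        exact (M p hp).step_sub_step_eventually_eq (M q hqD) hq hpq
      · rw [dif_neg hqD]
        simpa using (M p hp).step_eventually_eq hq hqD
    · rw [dif_neg hp] at hq ⊢
      rw [dif_neg hq]
      simp
  obtain ⟨g, hg⟩ := exists_map_to_circle hUo hUm hcompat
  refine ⟨g, fun γ hγ k hk hk0 => hg _ k fun s => ?_, fun k hk hk0 => hg _ k fun θ => ?_⟩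
  · change HasJump (fun r : ℝ => (h (γ.toFun s) (γ.toFun (s + (r : UnitAddCircle))) : ℝ)) 0 (k s)
    rw [hh]
    by_cases hs : γ.toFun s ∈ Set.range K.proj.toFun
    · rw [dif_pos hs]
      have h1 := (M _ hs).proj_θ₁
      have htr := hγ.transverse s _ h1.symm
      rw [tangentArea_swap, neg_ne_zero] at htr
      rw [hk s _ h1.symm, ← (M _ hs).n₁_eq]
      exact (M _ hs).hasJump_step_curve
        (fun hd => (M _ hs).ne hd (hγ.eq_of_proj_eq h1.symm ((M _ hs).proj_θ₂ hd).symm)) rfl htr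
    · rw [dif_neg hs, hk0 s hs]
      rw [Int.cast_zero]
      exact hasJump_zero_iff.2 ⟨0, by simp⟩
  · change HasJump (fun r : ℝ =>
      (h (K.proj.toFun θ) (K.proj.toFun (θ + (r : UnitAddCircle))) : ℝ)) 0 (k θ)
    have hθ : K.proj.toFun θ ∈ Set.range K.proj.toFun := ⟨θ, rfl⟩
    rw [hh, dif_pos hθ]
    set N := M _ hθ
    have move : ∀ φ, θ = φ → ∀ j,
        HasJump (fun r : ℝ => (N.step (K.proj.toFun (φ + (r : UnitAddCircle))) : ℝ)) 0 j →
        HasJump (fun r : ℝ => (N.step (K.proj.toFun (θ + (r : UnitAddCircle))) : ℝ)) 0 j := by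
      rintro _ rfl _ h
      exact h
    by_cases hd : N.double
    · have horient := N.orient_eq_sgn hd
      rcases hK.no_triple θ N.θ₁ N.θ₂ N.proj_θ₁.symm (N.proj_θ₁.trans (N.proj_θ₂ hd).symm)
        with e | e | e
      · have h1 := N.hasJump_step_fst
        have h2 := hk N.θ₁ N.θ₂ (N.ne hd) (N.proj_θ₁.trans (N.proj_θ₂ hd).symm)
        rw [tangentArea_swap, sgn_neg, horient, ← N.n₂_eq hd] at h2
        rw [congrArg k e, h2]
        convert move _ e _ h1 using 2
        ring
      · exact absurd e (N.ne hd)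
      · have h1 := N.hasJump_step_snd hd
        have h2 := hk N.θ₂ N.θ₁ (N.ne hd).symm ((N.proj_θ₂ hd).trans N.proj_θ₁.symm)
        rw [horient, ← N.n₁_eq] at h2
        rw [congrArg k e, h2]
        convert move _ e _ h1 using 2
        ring
    · have h1 := move _ (N.eq_of_proj_eq hd θ rfl) _ N.hasJump_step_fst
      rw [(N.weight_simple hd).1] at h1
      rw [hk0 θ fun θ' hθ' => (N.eq_of_proj_eq hd θ rfl).trans
        (N.eq_of_proj_eq hd θ' hθ'.symm).symm]
      simpa using h1

/-- The parameters of the intersections of a diagram with a curve in general position. -/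
def ThickenedKnot.meets (K : ThickenedKnot S) (γ : ClosedCurve S) :
    Set (UnitAddCircle × UnitAddCircle) :=
  {x | γ.toFun x.1 = K.proj.toFun x.2}

/-- The pairs of distinct parameters of the diagram that belong to the same point. -/
def ThickenedKnot.selfMeets (K : ThickenedKnot S) : Set (UnitAddCircle × UnitAddCircle) :=
  {x | x.1 ≠ x.2 ∧ K.proj.toFun x.1 = K.proj.toFun x.2}

theorem isBalanced_one (K : ThickenedKnot S) : IsBalanced K fun _ => 1 :=
  ⟨fun _ _ => by simp, fun _ _ _ _ => ⟨0, by simp⟩⟩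

theorem exists_weight_function {T : Set (UnitAddCircle × UnitAddCircle)}
    (huniq : ∀ s θ θ', (s, θ) ∈ T → (s, θ') ∈ T → θ = θ')
    (w : UnitAddCircle × UnitAddCircle → ℤ) :
    ∃ k : UnitAddCircle → ℤ, (∀ s θ, (s, θ) ∈ T → k s = w (s, θ)) ∧
      ∀ s, (∀ θ, (s, θ) ∉ T) → k s = 0 := by
  classical
  refine ⟨fun s => if h : ∃ θ, (s, θ) ∈ T then w (s, h.choose) else 0, fun s θ h => ?_,
    fun s h => ?_⟩
  · have h' : ∃ θ, (s, θ) ∈ T := ⟨θ, h⟩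
    simp only [dif_pos h']
    rw [huniq s _ _ h'.choose_spec h]
  · exact dif_neg fun ⟨θ, hθ⟩ => h θ hθ

theorem sum_weight_function {T : Finset (UnitAddCircle × UnitAddCircle)}
    (huniq : ∀ s θ θ', (s, θ) ∈ T → (s, θ') ∈ T → θ = θ')
    {w : UnitAddCircle × UnitAddCircle → ℤ} {k : UnitAddCircle → ℤ}
    (hk : ∀ s θ, (s, θ) ∈ T → k s = w (s, θ)) (hk0 : ∀ s, (∀ θ, (s, θ) ∉ T) → k s = 0)
    {P : Finset UnitAddCircle} (hP : ∀ s, s ∈ P ↔ k s ≠ 0) :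
    ∑ s ∈ P, k s = ∑ x ∈ T, w x := by
  classical
  have h1 : P ⊆ T.image Prod.fst := fun s hs => by
    by_contra h
    exact (hP s).1 hs (hk0 s fun θ hθ => h (Finset.mem_image_of_mem Prod.fst hθ))
  rw [Finset.sum_subset h1 fun s _ hs => not_not.1 fun h => hs ((hP s).2 h),
    Finset.sum_image fun x hx y hy hxy => Prod.ext hxy (huniq y.1 _ _ (by
      rw [← hxy]; exact hx) hy)]
  exact Finset.sum_congr rfl fun x hx => hk x.1 x.2 hx

/-- The diagram has finitely many intersections with a curve in general position. -/
theorem ThickenedKnot.IsGeneric.finite_meets [T2Space S] [CompactSpace S] [IsManifold (𝓡 2) ∞ S]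
    [OrientedAtlas S] {K : ThickenedKnot S} (hK : K.IsRegular) {γ : ClosedCurve S}
    (hγ : K.IsGeneric γ) : (K.meets γ).Finite := by
  obtain ⟨g, hg, -⟩ := exists_circle_map hK (isBalanced_one K)
  have huniq : ∀ s θ θ', (s, θ) ∈ K.meets γ → (s, θ') ∈ K.meets γ → θ = θ' :=
    fun s θ θ' h h' => hγ.eq_of_proj_eq h h'
  obtain ⟨k, hk, hk0⟩ := exists_weight_function huniq
    fun x => 2 * (1 * sgn (tangentArea K.proj.toFun γ.toFun x.2 x.1))
  obtain ⟨P, hP, -⟩ := hg γ hγ k (fun s θ h => hk s θ h)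
    fun s hs => hk0 s fun θ hθ => hs ⟨θ, Eq.symm hθ⟩
  refine Set.Finite.of_finite_image (f := Prod.fst) (P.finite_toSet.subset ?_) ?_
  · rintro _ ⟨⟨s, θ⟩, hx, rfl⟩
    rw [Finset.mem_coe, hP, hk s θ hx]
    have htr := hγ.transverse s θ hx
    rw [tangentArea_swap, neg_ne_zero] at htr
    have := mt sgn_eq_zero.1 htr
    simpa using this
  · rintro ⟨s, θ⟩ hx ⟨s', θ'⟩ hy (rfl : s = s')
    rw [huniq s θ θ' hx hy]

/-- If a curve in general position is homologous to the diagram, then for each balanced weight its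
weighted intersection number with the diagram equals the weighted self-intersection number of the
diagram. -/
theorem sum_meets_eq_sum_selfMeets [T2Space S] [CompactSpace S] [IsManifold (𝓡 2) ∞ S]
    [OrientedAtlas S] {K : ThickenedKnot S} (hK : K.IsRegular) {γ : ClosedCurve S}
    (hγ : K.IsGeneric γ) (hhom : γ.homologyClass = K.homologyClass) {n : UnitAddCircle → ℤ}
    (hn : IsBalanced K n) {T T' : Finset (UnitAddCircle × UnitAddCircle)}
    (hT : ∀ x, x ∈ T ↔ x ∈ K.meets γ) (hT' : ∀ x, x ∈ T' ↔ x ∈ K.selfMeets) :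
    ∑ x ∈ T, n x.2 * sgn (tangentArea K.proj.toFun γ.toFun x.2 x.1) =
      ∑ x ∈ T', n x.2 * sgn (tangentArea K.proj.toFun K.proj.toFun x.2 x.1) := by
  obtain ⟨g, hg, hg'⟩ := exists_circle_map hK hn
  have huniq : ∀ s θ θ', (s, θ) ∈ T → (s, θ') ∈ T → θ = θ' := fun s θ θ' h h' =>
    hγ.eq_of_proj_eq ((hT _).1 h) ((hT _).1 h')
  have huniq' : ∀ s θ θ', (s, θ) ∈ T' → (s, θ') ∈ T' → θ = θ' := fun s θ θ' h h' => by
    obtain ⟨h1, h2⟩ := (hT' _).1 h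
    obtain ⟨h3, h4⟩ := (hT' _).1 h'
    rcases hK.no_triple θ s θ' h2.symm h4 with e | e | e
    · exact absurd e.symm h1
    · exact absurd e h3
    · exact e
  obtain ⟨k, hk, hk0⟩ := exists_weight_function (T := T) huniq
    fun x => 2 * (n x.2 * sgn (tangentArea K.proj.toFun γ.toFun x.2 x.1))
  obtain ⟨k', hk', hk0'⟩ := exists_weight_function (T := T') huniq'
    fun x => 2 * (n x.2 * sgn (tangentArea K.proj.toFun K.proj.toFun x.2 x.1))
  obtain ⟨P, hP, hsum⟩ := hg γ hγ k (fun s θ h => hk s θ ((hT (s, θ)).2 h))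
    fun s hs => hk0 s fun θ hθ => hs ⟨θ, Eq.symm ((hT _).1 hθ)⟩
  obtain ⟨P', hP', hsum'⟩ := hg' k' (fun θ θ' hne h => hk' θ θ' ((hT' (θ, θ')).2 ⟨hne, h⟩))
    fun θ h => hk0' θ fun θ' hθ' => ((hT' _).1 hθ').1 (h θ' ((hT' _).1 hθ').2)
  have heq := angleCochain_loopSimplex_eq g hhom
  rw [hsum, hsum', neg_inj] at heq
  have heq' : ∑ s ∈ P, k s = ∑ s ∈ P', k' s := by exact_mod_cast heq
  rw [sum_weight_function (w := fun x => 2 * (n x.2 * sgn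
      (tangentArea K.proj.toFun γ.toFun x.2 x.1))) huniq hk hk0 hP,
    sum_weight_function (w := fun x => 2 * (n x.2 * sgn
      (tangentArea K.proj.toFun K.proj.toFun x.2 x.1))) huniq' hk' hk0' hP',
    ← Finset.mul_sum, ← Finset.mul_sum] at heq'
  exact mul_left_cancel₀ two_ne_zero heq'

/-- The algebraic self-intersection number of the diagram vanishes. -/
theorem sum_selfMeets_eq_zero {K : ThickenedKnot S}
    {T' : Finset (UnitAddCircle × UnitAddCircle)} (hT' : ∀ x, x ∈ T' ↔ x ∈ K.selfMeets) :
    ∑ x ∈ T', sgn (tangentArea K.proj.toFun K.proj.toFun x.2 x.1) = 0 := by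
  refine Finset.sum_involution (fun x _ => x.swap) (fun x _ => ?_) (fun x hx _ h => ?_)
    (fun x hx => ?_) fun x _ => x.swap_swap
  · rw [Prod.snd_swap, Prod.fst_swap, tangentArea_swap, sgn_neg, neg_add_cancel]
  · exact ((hT' x).1 hx).1 (congrArg Prod.snd h)
  · obtain ⟨h1, h2⟩ := (hT' x).1 hx
    exact (hT' _).2 ⟨h1.symm, h2.symm⟩

end Intersection

/-! ### The weight of a chord -/

section Chords

open Filter

open Classical in
/-- The function on the circle that is `1` on the open arc from `x` to `y`, `-1` on the open arc
from `y` to `x`, and `0` at `x` and `y`. -/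
noncomputable def arcWeight (x y θ : UnitAddCircle) : ℤ :=
  if θ ∈ Set.cIoo x y then 1 else if θ ∈ Set.cIoo y x then -1 else 0

theorem notMem_cIoo_left (x y : UnitAddCircle) : x ∉ Set.cIoo x y := fun h => h.2 (btw_refl_right y x)

theorem notMem_cIoo_right (x y : UnitAddCircle) : y ∉ Set.cIoo x y := fun h => h.2 (btw_refl_left y x)

theorem mem_cIoo_swap_iff {x y θ : UnitAddCircle} (hxy : x ≠ y) (hx : θ ≠ x) (hy : θ ≠ y) :
    θ ∈ Set.cIoo y x ↔ θ ∉ Set.cIoo x y := by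
  rw [Set.mem_cIoo, Set.mem_cIoo, sbtw_iff_not_btw, sbtw_iff_not_btw, not_not]
  refine ⟨fun h => (btw_total x θ y).resolve_left h, fun h h' => ?_⟩
  rcases btw_antisymm h h' with e | e | e
  exacts [hy e.symm, hx e, hxy e]

theorem arcWeight_left (x y : UnitAddCircle) : arcWeight x y x = 0 := by
  rw [arcWeight, if_neg (notMem_cIoo_left x y), if_neg (notMem_cIoo_right y x)]

theorem arcWeight_right (x y : UnitAddCircle) : arcWeight x y y = 0 := by
  rw [arcWeight, if_neg (notMem_cIoo_right x y), if_neg (notMem_cIoo_left y x)]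

theorem arcWeight_swap {x y : UnitAddCircle} (hxy : x ≠ y) (θ : UnitAddCircle) :
    arcWeight y x θ = -arcWeight x y θ := by
  by_cases hx : θ = x
  · rw [hx, arcWeight_left, arcWeight_right, neg_zero]
  by_cases hy : θ = y
  · rw [hy, arcWeight_left, arcWeight_right, neg_zero]
  have := mem_cIoo_swap_iff hxy hx hy
  by_cases h : θ ∈ Set.cIoo x y <;> simp [arcWeight, this, h]

theorem arcWeight_coe_of_mem {a b q : ℝ} (hb : b < a + 1) (hq : q ∈ Set.Ioo a b) :
    arcWeight (a : UnitAddCircle) b q = 1 :=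
  if_pos ((coe_mem_cIoo_iff ⟨(hq.1.trans hq.2).le, hb⟩ ⟨hq.1, hq.2.trans hb⟩).2 hq.2)

theorem arcWeight_coe_of_mem' {a b q : ℝ} (hab : b ∈ Set.Ioo a (a + 1))
    (hq : q ∈ Set.Ioo b (a + 1)) : arcWeight (a : UnitAddCircle) b q = -1 := by
  have ha : ((a + 1 : ℝ) : UnitAddCircle) = a := by simp
  have h := arcWeight_coe_of_mem (a := b) (b := a + 1) (by linarith [hab.1]) hq
  have hne : (a : UnitAddCircle) ≠ b := fun e => by
    obtain ⟨n, hn⟩ := coe_eq_coe_iff_exists_int.1 e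
    have h1 : (-1 : ℝ) < n := by rw [← hn]; linarith [hab.2]
    have h2 : (n : ℝ) < 0 := by rw [← hn]; linarith [hab.1]
    norm_cast at h1 h2
    lia
  rw [ha] at h
  rw [← neg_eq_iff_eq_neg, ← arcWeight_swap hne, h]

theorem exists_lifts {x y : UnitAddCircle} (hxy : x ≠ y) :
    ∃ a b : ℝ, b ∈ Set.Ioo a (a + 1) ∧ (a : UnitAddCircle) = x ∧ (b : UnitAddCircle) = y := by
  obtain ⟨a, rfl⟩ := QuotientAddGroup.mk_surjective x
  obtain ⟨b, hb, rfl⟩ := exists_coe_eq_of_mem_Ico a y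
  exact ⟨a, b, ⟨lt_of_le_of_ne hb.1 fun h => hxy (by rw [h]), hb.2⟩, rfl, rfl⟩

theorem arcWeight_eventually_eq {x y θ : UnitAddCircle} (hxy : x ≠ y) (hx : θ ≠ x) (hy : θ ≠ y) :
    ∀ᶠ r : ℝ in 𝓝 0, arcWeight x y (θ + (r : UnitAddCircle)) = arcWeight x y θ := by
  obtain ⟨a, b, hab, rfl, rfl⟩ := exists_lifts hxy
  obtain ⟨q, hq, rfl⟩ := exists_coe_eq_of_mem_Ico a θ
  have hqa : a < q := lt_of_le_of_ne hq.1 fun h => hx (by rw [h])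
  have hcont : Tendsto (fun r : ℝ => q + r) (𝓝 0) (𝓝 q) := by
    simpa using (continuous_const_add q).tendsto 0
  rcases lt_trichotomy q b with h | h | h
  · filter_upwards [hcont.eventually (Ioo_mem_nhds hqa h)] with r hr
    rw [← AddCircle.coe_add, arcWeight_coe_of_mem hab.2 hr, arcWeight_coe_of_mem hab.2 ⟨hqa, h⟩]
  · exact absurd (by rw [h]) hy
  · filter_upwards [hcont.eventually (Ioo_mem_nhds h hq.2)] with r hr
    rw [← AddCircle.coe_add, arcWeight_coe_of_mem' hab hr, arcWeight_coe_of_mem' hab ⟨h, hq.2⟩]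

theorem arcWeight_right_add_eventually_eq {x y : UnitAddCircle} (hxy : x ≠ y) :
    ∀ᶠ r : ℝ in 𝓝 0, arcWeight x y (y + (r : UnitAddCircle)) = -sgn r := by
  obtain ⟨a, b, hab, rfl, rfl⟩ := exists_lifts hxy
  have hcont : Tendsto (fun r : ℝ => b + r) (𝓝 0) (𝓝 b) := by
    simpa using (continuous_const_add b).tendsto 0
  filter_upwards [hcont.eventually (Ioo_mem_nhds hab.1 hab.2)] with r hr
  rcases lt_trichotomy r 0 with h | h | h
  · rw [← AddCircle.coe_add, arcWeight_coe_of_mem hab.2 ⟨hr.1, by linarith⟩, sgn_of_neg h, neg_neg]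
  · rw [h, AddCircle.coe_zero, add_zero, arcWeight_right, sgn_zero, neg_zero]
  · rw [← AddCircle.coe_add, arcWeight_coe_of_mem' hab ⟨by linarith, hr.2⟩, sgn_of_pos h]

theorem arcWeight_left_add_eventually_eq {x y : UnitAddCircle} (hxy : x ≠ y) :
    ∀ᶠ r : ℝ in 𝓝 0, arcWeight x y (x + (r : UnitAddCircle)) = sgn r := by
  filter_upwards [arcWeight_right_add_eventually_eq hxy.symm] with r hr
  rw [arcWeight_swap hxy.symm, hr, neg_neg]

/-- The chord index, in terms of the weight of the chord: the endpoints of a chord that crosses the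
given one contribute equally. -/
theorem GaussDiagram.two_mul_ind (G : GaussDiagram) [Fintype G.Chord] (c : G.Chord) :
    2 * G.ind c = ∑ c', (G.sign c' : ℤ) * (arcWeight (G.head c) (G.tail c) (G.tail c') -
      arcWeight (G.head c) (G.tail c) (G.head c')) := by
  classical
  have hinj := G.endpoints_injective
  have hne : ∀ c c', G.head c ≠ G.tail c' := fun c c' h => by
    simpa using hinj (a₁ := Sum.inr c) (a₂ := Sum.inl c') h
  simp only [GaussDiagram.ind, GaussDiagram.numLeftToRight, GaussDiagram.numRightToLeft,
    Nat.card_eq_fintype_card, Fintype.card_subtype, Finset.card_filter, Nat.cast_sum,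
    ← Finset.sum_sub_distrib, ← Finset.sum_add_distrib, Finset.mul_sum]
  refine Finset.sum_congr rfl fun c' _ => ?_
  rw [GaussDiagram.leftArc, GaussDiagram.rightArc]
  by_cases hc : c' = c
  · subst hc
    simp [arcWeight_left, arcWeight_right, notMem_cIoo_left, notMem_cIoo_right, -Set.mem_cIoo]
  have ht : G.tail c' ≠ G.tail c := fun h => hc (by
    simpa using hinj (a₁ := Sum.inl c') (a₂ := Sum.inl c) h)
  have hh : G.head c' ≠ G.head c := fun h => hc (by
    simpa using hinj (a₁ := Sum.inr c') (a₂ := Sum.inr c) h)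
  have h1 := mem_cIoo_swap_iff (hne c c) (hne c c').symm ht
  have h2 := mem_cIoo_swap_iff (hne c c) hh (hne c' c)
  rw [arcWeight, arcWeight, h1, h2]
  by_cases h3 : G.tail c' ∈ Set.cIoo (G.head c) (G.tail c) <;>
    by_cases h4 : G.head c' ∈ Set.cIoo (G.head c) (G.tail c) <;>
    rcases Int.units_eq_one_or (G.sign c') with h5 | h5 <;> simp [h3, h4, h5]

end Chords

/-! ### Chord indices and colorings -/

section Colorings

open Filter

variable {S : Type u} [TopologicalSpace S] [ChartedSpace Plane S] {K : ThickenedKnot S}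

/-- The weight of a chord is balanced: at its endpoints it jumps by `2` and by `-2`, and these two
jumps are at the same crossing point. -/
theorem isBalanced_arcWeight (hK : K.IsRegular) (c : K.Crossing) :
    IsBalanced K (arcWeight c.underParam c.overParam) := by
  have hne := c.over_ne_under
  have hleft := arcWeight_left_add_eventually_eq hne.symm
  have hright := arcWeight_right_add_eventually_eq hne.symm
  refine ⟨fun θ hθ => arcWeight_eventually_eq hne.symm ?_ ?_, fun θ θ' hθ h => ?_⟩
  · rintro rfl
    exact hne (hθ _ c.proj_eq)
  · rintro rfl
    exact hne (hθ _ c.proj_eq.symm).symm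
  · by_cases h1 : θ = c.underParam
    · have h2 : θ' = c.overParam := by
        rcases hK.no_triple c.overParam θ θ' (h1 ▸ c.proj_eq) h with e | e | e
        exacts [absurd (e.trans h1) hne, absurd e hθ, e.symm]
      refine ⟨1, ?_⟩
      rw [h1, h2, arcWeight_left, arcWeight_right]
      filter_upwards [hleft, hright] with r hr hr'
      exact ⟨by rw [hr]; ring, by rw [hr']; ring⟩
    by_cases h2 : θ = c.overParam
    · have h3 : θ' = c.underParam := by
        rcases hK.no_triple c.underParam θ θ' (h2 ▸ c.proj_eq.symm) h with e | e | e
        exacts [absurd (e.trans h2).symm hne, absurd e hθ, e.symm]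
      refine ⟨-1, ?_⟩
      rw [h2, h3, arcWeight_left, arcWeight_right]
      filter_upwards [hleft, hright] with r hr hr'
      exact ⟨by rw [hr']; ring, by rw [hr]; ring⟩
    have h3 : θ' ≠ c.underParam := fun e => by
      rcases hK.no_triple θ c.underParam c.overParam (e ▸ h) c.proj_eq.symm with e' | e' | e'
      exacts [h1 e', hne e'.symm, h2 e']
    have h4 : θ' ≠ c.overParam := fun e => by
      rcases hK.no_triple θ c.overParam c.underParam (e ▸ h) c.proj_eq with e' | e' | e'
      exacts [h2 e', hne e', h1 e']
    refine ⟨0, ?_⟩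
    filter_upwards [arcWeight_eventually_eq hne.symm h1 h2,
      arcWeight_eventually_eq hne.symm h3 h4] with r hr hr'
    exact ⟨by rw [hr]; ring, by rw [hr']; ring⟩

theorem ThickenedKnot.Crossing.sgn_tangentArea (hK : K.IsRegular) (c : K.Crossing) :
    sgn (tangentArea K.proj.toFun K.proj.toFun c.overParam c.underParam) = (c.writhe : ℤ) := by
  rw [ThickenedKnot.Crossing.writhe]
  split_ifs with h
  · rw [sgn_of_pos h, Units.val_one]
  · rw [sgn_of_neg (lt_of_le_of_ne (not_lt.1 h)
      (hK.transverse _ _ c.over_ne_under c.proj_eq)), Units.val_neg, Units.val_one]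

/-- A weighted self-intersection number of the diagram as a sum over the crossings. -/
theorem sum_selfMeets_eq_sum_crossing (hK : K.IsRegular) [Fintype K.Crossing]
    (n : UnitAddCircle → ℤ) {T : Finset (UnitAddCircle × UnitAddCircle)}
    (hT : ∀ x, x ∈ T ↔ x ∈ K.selfMeets) :
    ∑ x ∈ T, n x.2 * sgn (tangentArea K.proj.toFun K.proj.toFun x.2 x.1) =
      ∑ c : K.Crossing, (c.writhe : ℤ) * (n c.overParam - n c.underParam) := by
  have h1 : ∑ s : K.Crossing ⊕ K.Crossing,
      Sum.elim (fun c : K.Crossing => (c.writhe : ℤ) * n c.overParam)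
        (fun c : K.Crossing => -((c.writhe : ℤ) * n c.underParam)) s =
      ∑ x ∈ T, n x.2 * sgn (tangentArea K.proj.toFun K.proj.toFun x.2 x.1) := by
    refine Finset.sum_bij (fun s _ => Sum.elim (fun c : K.Crossing => (c.underParam, c.overParam))
      (fun c : K.Crossing => (c.overParam, c.underParam)) s) ?_ ?_ ?_ ?_
    · rintro (c | c) -
      · exact (hT _).2 ⟨c.over_ne_under.symm, c.proj_eq.symm⟩
      · exact (hT _).2 ⟨c.over_ne_under, c.proj_eq⟩
    · rintro (c | c) - (c' | c') - h
      · exact congrArg _ (ThickenedKnot.Crossing.ext (congrArg Prod.snd h) (congrArg Prod.fst h))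
      · simpa using hK.endpoints_injective (a₁ := Sum.inl c) (a₂ := Sum.inr c') (congrArg Prod.snd h)
      · simpa using hK.endpoints_injective (a₁ := Sum.inl c) (a₂ := Sum.inr c') (congrArg Prod.fst h)
      · exact congrArg _ (ThickenedKnot.Crossing.ext (congrArg Prod.fst h) (congrArg Prod.snd h))
    · intro x hx
      obtain ⟨hne, hx'⟩ := (hT x).1 hx
      obtain ⟨c, ⟨hc, hc'⟩ | ⟨hc, hc'⟩⟩ := ThickenedKnot.exists_crossing hne hx'
      · exact ⟨Sum.inr c, Finset.mem_univ _, Prod.ext hc hc'⟩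
      · exact ⟨Sum.inl c, Finset.mem_univ _, Prod.ext hc' hc⟩
    · rintro (c | c) -
      · simp only [Sum.elim_inl]
        rw [c.sgn_tangentArea hK, mul_comm]
      · simp only [Sum.elim_inr]
        rw [tangentArea_swap, sgn_neg, c.sgn_tangentArea hK]
        ring
  rw [← h1, Fintype.sum_sum_type, ← Finset.sum_add_distrib]
  refine Finset.sum_congr rfl fun c _ => ?_
  simp only [Sum.elim_inl, Sum.elim_inr]
  ring

variable {γ : ClosedCurve S} {T : Finset (UnitAddCircle × UnitAddCircle)}

theorem jump_eq_sum [DecidableEq UnitAddCircle] (hT : ∀ x, x ∈ T ↔ x ∈ K.meets γ)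
    (θ : UnitAddCircle) :
    K.jump γ θ = ∑ x ∈ T with x.2 = θ, sgn (tangentArea K.proj.toFun γ.toFun x.2 x.1) := by
  have h1 : {s | γ.toFun s = K.proj.toFun θ} =
      ((T.filter fun x => x.2 = θ).image Prod.fst : Finset UnitAddCircle) := by
    ext s
    simp only [Set.mem_ofPred_eq, Finset.coe_image, Finset.coe_filter, Set.mem_image, Prod.exists,
      exists_and_right, exists_eq_right]
    exact (hT (s, θ)).symm
  change ∑ᶠ s ∈ {s | γ.toFun s = K.proj.toFun θ}, sgn (tangentArea K.proj.toFun γ.toFun θ s) = _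
  rw [h1, finsum_mem_coe_finset, Finset.sum_image]
  · refine Finset.sum_congr rfl fun x hx => ?_
    rw [(Finset.mem_filter.1 hx).2]
  · intro x hx y hy h
    exact Prod.ext h ((Finset.mem_filter.1 hx).2.trans (Finset.mem_filter.1 hy).2.symm)

theorem jump_eq_zero {θ : UnitAddCircle} (h : K.proj.toFun θ ∉ Set.range γ.toFun) :
    K.jump γ θ = 0 :=
  finsum_mem_of_eqOn_zero (s := {s | γ.toFun s = K.proj.toFun θ}) fun s hs => absurd ⟨s, hs⟩ h

/-- A weighted intersection number as a sum over the diagram. -/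
theorem sum_meets_eq_sum_jump [DecidableEq UnitAddCircle] (hT : ∀ x, x ∈ T ↔ x ∈ K.meets γ)
    (n : UnitAddCircle → ℤ) :
    ∑ x ∈ T, n x.2 * sgn (tangentArea K.proj.toFun γ.toFun x.2 x.1) =
      ∑ θ ∈ T.image Prod.snd, n θ * K.jump γ θ := by
  rw [← Finset.sum_fiberwise_of_maps_to (t := T.image Prod.snd) (g := Prod.snd)
    fun x hx => Finset.mem_image_of_mem Prod.snd hx]
  refine Finset.sum_congr rfl fun θ _ => ?_
  rw [jump_eq_sum hT, Finset.mul_sum]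
  refine Finset.sum_congr rfl fun x hx => ?_
  rw [(Finset.mem_filter.1 hx).2]

theorem mem_image_snd_meets_iff [DecidableEq UnitAddCircle] (hT : ∀ x, x ∈ T ↔ x ∈ K.meets γ)
    {θ : UnitAddCircle} : θ ∈ T.image Prod.snd ↔ K.proj.toFun θ ∈ Set.range γ.toFun := by
  simp only [Finset.mem_image, Prod.exists, exists_eq_right, hT]
  rfl

/-- If the jumps along the diagram have total zero, then there is a coloring. -/
theorem exists_isColoring [DecidableEq UnitAddCircle] (hT : ∀ x, x ∈ T ↔ x ∈ K.meets γ)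
    (hsum : ∑ θ ∈ T.image Prod.snd, K.jump γ θ = 0) : ∃ χ, K.IsColoring γ χ := by
  obtain ⟨χ, h1, h2⟩ := exists_step_function (P := T.image Prod.snd) (k := K.jump γ)
    (fun p hp => jump_eq_zero (mt (mem_image_snd_meets_iff hT).2 hp)) hsum
  exact ⟨χ, fun θ hθ => h1 θ (mt (mem_image_snd_meets_iff hT).1 hθ), fun θ _ => h2 θ⟩

theorem ThickenedKnot.IsColoring.hasJump {χ : UnitAddCircle → ℤ} (hχ : K.IsColoring γ χ)
    (θ : UnitAddCircle) :
    HasJump (fun r : ℝ => (χ (θ + (r : UnitAddCircle)) : ℝ)) 0 (K.jump γ θ) := by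
  by_cases hθ : K.proj.toFun θ ∈ Set.range γ.toFun
  · obtain ⟨a, h1, h2⟩ := hχ.jumps θ hθ
    refine ⟨a, h1.mono fun r hr => congrArg Int.cast hr,
      h2.mono fun r hr => (congrArg Int.cast hr).trans (Int.cast_add _ _)⟩
  · rw [jump_eq_zero hθ, Int.cast_zero, hasJump_zero_iff]
    have hcont : Tendsto (fun r : ℝ => θ + (r : UnitAddCircle)) (𝓝 0) (𝓝 θ) := by
      refine ((continuous_const_add θ).comp (AddCircle.continuous_mk' 1)).tendsto' 0 _ ?_
      simp
    exact ⟨χ θ, (hcont.eventually (hχ.locally_constant θ hθ)).filter_mono nhdsWithin_le_nhds |>.mono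
      fun r hr => by rw [hr]⟩

/-- The colors of the two branches at a crossing differ by the sum of the jumps on the arc between
them. -/
theorem ThickenedKnot.IsColoring.chordIndex_eq [DecidableEq UnitAddCircle]
    (hgen : K.IsGeneric γ) (hT : ∀ x, x ∈ T ↔ x ∈ K.meets γ) {χ : UnitAddCircle → ℤ}
    (hχ : K.IsColoring γ χ) (c : K.Crossing) :
    2 * ThickenedKnot.chordIndex χ c = ∑ θ ∈ T.image Prod.snd,
      (1 + arcWeight c.underParam c.overParam θ) * K.jump γ θ := by
  classical
  have hne := c.over_ne_under
  have hover : K.proj.toFun c.overParam ∉ Set.range γ.toFun := fun ⟨s, hs⟩ => hgen.avoids c s hs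
  have hunder : K.proj.toFun c.underParam ∉ Set.range γ.toFun := c.proj_eq ▸ hover
  have h := sub_eq_sum_jumps (f := fun θ => (χ θ : ℝ))
    (P := (T.image Prod.snd).filter fun θ => K.jump γ θ ≠ 0) (k := K.jump γ)
    (fun p => by
      rw [Finset.mem_filter, and_iff_right_iff_imp]
      exact fun hp => (mem_image_snd_meets_iff hT).2 (not_not.1 (mt jump_eq_zero hp)))
    hχ.hasJump hne.symm ((hχ.locally_constant _ hunder).mono fun r hr => by rw [hr])
    ((hχ.locally_constant _ hover).mono fun r hr => by rw [hr])
  have h' : ThickenedKnot.chordIndex χ c = ∑ θ ∈ (T.image Prod.snd).filter fun θ =>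
      K.jump γ θ ≠ 0 with θ ∈ Set.cIoo c.underParam c.overParam, K.jump γ θ := by
    rw [ThickenedKnot.chordIndex]
    exact_mod_cast h
  rw [h', Finset.sum_filter, Finset.sum_filter, Finset.mul_sum]
  refine Finset.sum_congr rfl fun θ hθ => ?_
  rw [mem_image_snd_meets_iff hT] at hθ
  have hu : θ ≠ c.underParam := fun e => hunder (e ▸ hθ)
  have ho : θ ≠ c.overParam := fun e => hover (e ▸ hθ)
  rw [arcWeight, mem_cIoo_swap_iff hne.symm hu ho]
  by_cases h1 : θ ∈ Set.cIoo c.underParam c.overParam <;>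
    by_cases h2 : K.jump γ θ = 0 <;> simp [h1, h2]

end Colorings

theorem lemma5p2 {S : Type u} [TopologicalSpace S] [T2Space S] [CompactSpace S]
    [ChartedSpace Plane S] [IsManifold (𝓡 2) ∞ S] [OrientedAtlas S]
    (K : ThickenedKnot S) (hK : K.IsRegular)
    (γ : ClosedCurve S) (hgen : K.IsGeneric γ) (hγ : γ.homologyClass = K.homologyClass) :
    (∃ χ : UnitAddCircle → ℤ, K.IsColoring γ χ) ∧
      ∀ χ : UnitAddCircle → ℤ, K.IsColoring γ χ →
        (∀ c : K.Crossing, ThickenedKnot.chordIndex χ c = (K.gaussDiagram hK).ind c) ∧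
          K.writhePolynomial χ = (K.gaussDiagram hK).writhePolynomial := by
  classical
  have hT : ∀ x, x ∈ (hgen.finite_meets hK).toFinset ↔ x ∈ K.meets γ := fun x =>
    (hgen.finite_meets hK).mem_toFinset
  have hT' : ∀ x, x ∈ hK.finite.toFinset ↔ x ∈ K.selfMeets := fun x => hK.finite.mem_toFinset
  generalize (hgen.finite_meets hK).toFinset = T at hT
  have htotal : ∑ θ ∈ T.image Prod.snd, K.jump γ θ = 0 := by
    have h := sum_meets_eq_sum_selfMeets hK hgen hγ (isBalanced_one K) hT hT'
    have h' := sum_meets_eq_sum_jump hT fun _ => 1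
    simp only [one_mul] at h h'
    rw [← h', h, sum_selfMeets_eq_zero hT']
  refine ⟨exists_isColoring hT htotal, fun χ hχ => ?_⟩
  have hind : ∀ c : K.Crossing,
      ThickenedKnot.chordIndex χ c = (K.gaussDiagram hK).ind c := fun c => by
    have := hK.finite_crossing
    have := Fintype.ofFinite K.Crossing
    let _ : Fintype (K.gaussDiagram hK).Chord := ‹Fintype K.Crossing›
    refine mul_left_cancel₀ (two_ne_zero (α := ℤ)) ?_
    rw [hχ.chordIndex_eq hgen hT c, (K.gaussDiagram hK).two_mul_ind c]
    simp only [add_mul, one_mul, Finset.sum_add_distrib, htotal, zero_add]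
    rw [← sum_meets_eq_sum_jump hT,
      sum_meets_eq_sum_selfMeets hK hgen hγ (isBalanced_arcWeight hK c) hT hT',
      sum_selfMeets_eq_sum_crossing hK _ hT']
    rfl
  refine ⟨hind, ?_⟩
  rw [ThickenedKnot.writhePolynomial, funext hind]
  rfl
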